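/- Let $(M,g)$ be a smooth $n$-dimensional Riemannian manifold, $n>2$, with Ricci tensor $S$, Ricci operator $Q$ (given by $g(QX,Y)=S(X,Y)$) and scalar curvature $\mathrm{scal}$. Let $\xi$ be a smooth vector field on $M$, let $\eta=g(\xi,\cdot)$ be its $g$-dual $1$-form, and let $\lambda,\mu$ be real constants such that $(g,\xi,\lambda,\mu)$ is an $\eta$-Ricci soliton, that is, $$L_\xi g+2S+2\lambda g+2\mu\,\eta\otimes\eta=0 .$$ Assume that $\eta$ is harmonic in the sense that it is closed and divergence-free ($d\eta=0$ and $\mathrm{div}\,\xi=0$). Then: (i) $\xi\in\ker Q$, i.e. $Q\xi=0$ on $M$; (ii) if $M$ is connected or $\mu\neq 0$, then the scalar curvature of $M$ is constant if and only if $\xi$ has constant length. -/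

import Mathlib

open Bundle VectorField
open scoped Manifold ContDiff

noncomputable section
set_option linter.unusedSimpArgs false
set_option linter.unusedSectionVars false

namespace RicciSoliton

variable {E : Type*} [NormedAddCommGroup E] [NormedSpace ℝ E]
  {H : Type*} [TopologicalSpace H] (I : ModelWithCorners ℝ E H)
  {M : Type*} [TopologicalSpace M] [ChartedSpace H M]
  [RiemannianBundle (fun x : M ↦ TangentSpace I x)]

/-- The right-hand side of Koszul's formula, `2 g(∇_X Y, Z)` at `x`. -/
def koszul (X Y Z : Π x : M, TangentSpace I x) (x : M) : ℝ :=
  d% (fun y ↦ inner ℝ (Y y) (Z y)) x (X x) + d% (fun y ↦ inner ℝ (X y) (Z y)) x (Y x)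
    - d% (fun y ↦ inner ℝ (X y) (Y y)) x (Z x) + inner ℝ (mlieBracket I X Y x) (Z x)
    - inner ℝ (mlieBracket I X Z x) (Y x) - inner ℝ (mlieBracket I Y Z x) (X x)

variable [FiniteDimensional ℝ E] [IsManifold I ∞ M]
  [IsContMDiffRiemannianBundle I ∞ E (fun x : M ↦ TangentSpace I x)]

variable {I} in
theorem mdiff_inner {X Y : Π x : M, TangentSpace I x} {x : M}
    (hX : MDiffAt (T% X) x) (hY : MDiffAt (T% Y) x) :
    MDiffAt (fun y ↦ inner ℝ (X y) (Y y)) x :=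
  MDifferentiableAt.inner_bundle (E := fun x : M ↦ TangentSpace I x) (b := fun y ↦ y) hX hY

variable {I} in
theorem koszul_tensorial_left {Y Z : Π x : M, TangentSpace I x} {x : M}
    (hY : MDiffAt (T% Y) x) (hZ : MDiffAt (T% Z) x) :
    TensorialAt I E (fun X ↦ koszul I X Y Z x) x where
  smul {f X} hf hX := by
    have h1 := mvfderiv_fun_mul hf (mdiff_inner hX hZ)
    have h2 := mvfderiv_fun_mul hf (mdiff_inner hX hY)
    simp only [koszul, Pi.smul_apply', real_inner_smul_left, real_inner_smul_right, h1, h2,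
      mlieBracket_smul_left hf hX, inner_add_left, inner_neg_left]
    simp [real_inner_smul_left, real_inner_smul_right]
    ring
  add {X X'} hX hX' := by
    have h1 := mvfderiv_fun_add (mdiff_inner hX hZ) (mdiff_inner hX' hZ)
    have h2 := mvfderiv_fun_add (mdiff_inner hX hY) (mdiff_inner hX' hY)
    simp only [koszul, Pi.add_apply, inner_add_left, inner_add_right, h1, h2,
      mlieBracket_add_left hX hX', map_add, add_apply]
    ring

variable {I} in
theorem koszul_tensorial_right {X Y : Π x : M, TangentSpace I x} {x : M}
    (hX : MDiffAt (T% X) x) (hY : MDiffAt (T% Y) x) :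
    TensorialAt I E (fun Z ↦ koszul I X Y Z x) x where
  smul {f Z} hf hZ := by
    have h1 := mvfderiv_fun_mul hf (mdiff_inner hY hZ)
    have h2 := mvfderiv_fun_mul hf (mdiff_inner hX hZ)
    simp only [koszul, Pi.smul_apply', real_inner_smul_left, real_inner_smul_right, h1, h2,
      mlieBracket_smul_right hf hZ, inner_add_left]
    simp [real_inner_smul_left, real_inner_smul_right]
    rw [real_inner_comm (Z x) (Y x), real_inner_comm (Z x) (X x)]
    ring
  add {Z Z'} hZ hZ' := by
    have h1 := mvfderiv_fun_add (mdiff_inner hY hZ) (mdiff_inner hY hZ')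
    have h2 := mvfderiv_fun_add (mdiff_inner hX hZ) (mdiff_inner hX hZ')
    simp only [koszul, Pi.add_apply, inner_add_left, inner_add_right, h1, h2,
      mlieBracket_add_right hZ hZ', map_add, add_apply]
    ring

theorem koszul_smul_mid {X Y Z : Π x : M, TangentSpace I x} {f : M → ℝ} {x : M}
    (hf : MDiffAt f x) (hX : MDiffAt (T% X) x) (hY : MDiffAt (T% Y) x) (hZ : MDiffAt (T% Z) x) :
    koszul I X (f • Y) Z x = f x * koszul I X Y Z x + 2 * d% f x (X x) * inner ℝ (Y x) (Z x) := by
  have h1 := mvfderiv_fun_mul hf (mdiff_inner hY hZ)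
  have h2 := mvfderiv_fun_mul hf (mdiff_inner hX hY)
  simp only [koszul, Pi.smul_apply', real_inner_smul_left, real_inner_smul_right, h1, h2,
    mlieBracket_smul_left hf hY, mlieBracket_smul_right hf hY, inner_add_left, inner_neg_left]
  simp [real_inner_smul_left, real_inner_smul_right]
  rw [real_inner_comm (Y x) (X x)]
  ring

theorem koszul_add_mid {X Y Y' Z : Π x : M, TangentSpace I x} {x : M}
    (hX : MDiffAt (T% X) x) (hY : MDiffAt (T% Y) x) (hY' : MDiffAt (T% Y') x)
    (hZ : MDiffAt (T% Z) x) :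
    koszul I X (Y + Y') Z x = koszul I X Y Z x + koszul I X Y' Z x := by
  have h1 := mvfderiv_fun_add (mdiff_inner hY hZ) (mdiff_inner hY' hZ)
  have h2 := mvfderiv_fun_add (mdiff_inner hX hY) (mdiff_inner hX hY')
  simp only [koszul, Pi.add_apply, inner_add_left, inner_add_right, h1, h2,
    mlieBracket_add_left hY hY', mlieBracket_add_right hY hY', map_add,
    add_apply]
  ring

theorem koszul_sub_swap {X Y Z : Π x : M, TangentSpace I x} {x : M} :
    koszul I X Y Z x - koszul I Y X Z x = 2 * inner ℝ (mlieBracket I X Y x) (Z x) := by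
  have h : (fun y ↦ inner ℝ (X y) (Y y)) = fun y ↦ inner ℝ (Y y) (X y) :=
    funext fun y ↦ real_inner_comm _ _
  have h' : mlieBracket I Y X x = - mlieBracket I X Y x := mlieBracket_swap_apply
  simp only [koszul, h, h', inner_neg_left]
  ring

theorem koszul_add_swap {X Y Z : Π x : M, TangentSpace I x} {x : M} :
    koszul I X Y Z x + koszul I X Z Y x = 2 * d% (fun y ↦ inner ℝ (Y y) (Z y)) x (X x) := by
  have h : (fun y ↦ inner ℝ (Z y) (Y y)) = fun y ↦ inner ℝ (Y y) (Z y) :=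
    funext fun y ↦ real_inner_comm _ _
  have h' : mlieBracket I Z Y x = - mlieBracket I Y Z x := mlieBracket_swap_apply
  simp only [koszul, h, h', inner_neg_left]
  ring

variable (M) in
/-- Existence of the Levi-Civita connection: there is a torsion-free metric connection. -/
theorem exists_leviCivita :
    ∃ cov : CovariantDerivative I E (fun x : M ↦ TangentSpace I x),
      cov.torsion = 0 ∧ cov.IsMetricCompatible := by
  classical
  have key : ∀ (Y : Π x : M, TangentSpace I x) (x : M),
      ∃ L : TangentSpace I x →L[ℝ] TangentSpace I x, MDiffAt (T% Y) x →
        ∀ X Z : Π x : M, TangentSpace I x, MDiffAt (T% X) x → MDiffAt (T% Z) x →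
          2 * inner ℝ (L (X x)) (Z x) = koszul I X Y Z x := by
    intro Y x
    by_cases hY : MDiffAt (T% Y) x
    swap
    · exact ⟨0, fun h ↦ absurd h hY⟩
    have : FiniteDimensional ℝ (TangentSpace I x) := inferInstanceAs (FiniteDimensional ℝ E)
    let b := stdOrthonormalBasis ℝ (TangentSpace I x)
    let φ := TensorialAt.mkHom₂ (I := I) (F := E) (F' := E) (fun X Z ↦ koszul I X Y Z x) x
      (fun Z hZ ↦ koszul_tensorial_left hY hZ) (fun X hX ↦ koszul_tensorial_right hX hY)
    refine ⟨∑ i, (((1 / 2 : ℝ) • φ).flip (b i)).smulRight (b i), fun _ X Z hX hZ ↦ ?_⟩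
    have h1 : φ (X x) (Z x) = koszul I X Y Z x := TensorialAt.mkHom₂_apply _ _ hX hZ
    rw [← h1]
    conv_rhs => rw [← b.sum_repr (Z x)]
    simp only [map_sum, map_smul, sum_apply, sum_inner]
    rw [Finset.mul_sum]
    refine Finset.sum_congr rfl fun i _ ↦ ?_
    simp [real_inner_smul_left, b.repr_apply_apply]
    ring
  choose L hL using key
  have ext_inner : ∀ (x : M) (u v : TangentSpace I x),
      (∀ Z : Π x : M, TangentSpace I x, MDiffAt (T% Z) x →
        inner ℝ u (Z x) = inner ℝ v (Z x)) → u = v := by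
    intro x u v h
    refine ext_inner_right ℝ fun w ↦ ?_
    simpa using h (FiberBundle.extend E w) (FiberBundle.mdifferentiableAt_extend ..)
  let cov : CovariantDerivative I E (fun x : M ↦ TangentSpace I x) :=
    { toFun := L
      isCovariantDerivativeOnUniv :=
        { add := by
            intro Y Y' x hY hY' _
            ext v
            refine ext_inner x _ _ fun Z hZ ↦ ?_
            have hX := FiberBundle.mdifferentiableAt_extend (I := I) (F := E) (V := fun x : M ↦ TangentSpace I x) v
            have h1 := hL (Y + Y') x (mdifferentiableAt_add_section hY hY') _ Z hX hZ
            have h2 := hL Y x hY _ Z hX hZ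
            have h3 := hL Y' x hY' _ Z hX hZ
            rw [koszul_add_mid I hX hY hY' hZ] at h1
            simp only [FiberBundle.extend_apply_self] at h1 h2 h3
            simp only [add_apply, inner_add_left]
            linarith
          leibniz := by
            intro Y f x hY hf _
            ext v
            refine ext_inner x _ _ fun Z hZ ↦ ?_
            have hX := FiberBundle.mdifferentiableAt_extend (I := I) (F := E) (V := fun x : M ↦ TangentSpace I x) v
            have h1 := hL (f • Y) x (hf.smul_section hY) _ Z hX hZ
            have h2 := hL Y x hY _ Z hX hZ
            rw [koszul_smul_mid I hf hX hY hZ] at h1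
            simp only [FiberBundle.extend_apply_self] at h1 h2
            simp only [add_apply, inner_add_left, smul_apply,
              ContinuousLinearMap.smulRight_apply, real_inner_smul_left]
            rw [← h2] at h1
            linarith } }
  have hcov : ∀ {X Y Z : Π x : M, TangentSpace I x} {x : M}, MDiffAt (T% X) x →
      MDiffAt (T% Y) x → MDiffAt (T% Z) x →
      2 * inner ℝ (cov Y x (X x)) (Z x) = koszul I X Y Z x :=
    fun hX hY hZ ↦ hL _ _ hY _ _ hX hZ
  refine ⟨cov, ?_, ?_⟩
  · rw [CovariantDerivative.torsion_eq_zero_iff]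
    intro X Y x hX hY
    refine ext_inner x _ _ fun Z hZ ↦ ?_
    have h := koszul_sub_swap I (X := X) (Y := Y) (Z := Z) (x := x)
    rw [← hcov hX hY hZ, ← hcov hY hX hZ] at h
    rw [inner_sub_left]
    linarith
  · rw [CovariantDerivative.isMetricCompatible_iff]
    intro x X Y Z hX hY hZ
    have h := koszul_add_swap I (X := X) (Y := Y) (Z := Z) (x := x)
    rw [← hcov hX hY hZ, ← hcov hX hZ hY] at h
    rw [real_inner_comm (Y x)] at h
    linarith

variable (M) in
/-- The Levi-Civita connection: the torsion-free connection compatible with the metric.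
`leviCivita I M Y x v` is `∇_v Y` at `x`. (These two conditions determine it on all vector fields
that are differentiable at `x`.) -/
def leviCivita : CovariantDerivative I E (fun x : M ↦ TangentSpace I x) :=
  Classical.choose (exists_leviCivita I M)

theorem leviCivita_torsion : (leviCivita I M).torsion = 0 :=
  (Classical.choose_spec (exists_leviCivita I M)).1

theorem leviCivita_isMetricCompatible :
    CovariantDerivative.IsMetricCompatible (V := fun x : M ↦ TangentSpace I x) (leviCivita I M) :=
  (Classical.choose_spec (exists_leviCivita I M)).2

/-- The tangent spaces are finite-dimensional. -/
instance instFiniteDimensionalTangentSpace (x : M) : FiniteDimensional ℝ (TangentSpace I x) :=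
  inferInstanceAs (FiniteDimensional ℝ E)

/-- An orthonormal basis of the tangent space at `x`, used to take traces. -/
def tangentONB (x : M) :
    OrthonormalBasis (Fin (Module.finrank ℝ (TangentSpace I x))) ℝ (TangentSpace I x) :=
  stdOrthonormalBasis ℝ (TangentSpace I x)

/-- A vector field, smooth near `x`, whose value at `x` is the tangent vector `v`. Tensors are
evaluated on tangent vectors through such extensions. -/
def extendVec {x : M} (v : TangentSpace I x) : Π y : M, TangentSpace I y :=
  FiberBundle.extend E v

/-- The Riemann curvature tensor
`R(u, v) w = ∇_U ∇_V W - ∇_V ∇_U W - ∇_[U, V] W` at `x`, with `U, V, W` extending `u, v, w`. -/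
def curvature (x : M) (u v w : TangentSpace I x) : TangentSpace I x :=
  leviCivita I M (fun y ↦ leviCivita I M (extendVec I w) y (extendVec I v y)) x u
    - leviCivita I M (fun y ↦ leviCivita I M (extendVec I w) y (extendVec I u y)) x v
    - leviCivita I M (extendVec I w) x (mlieBracket I (extendVec I u) (extendVec I v) x)

/-- The Ricci tensor `S(v, w)`, the trace of `u ↦ R(u, v) w`. -/
def ricci (x : M) (v w : TangentSpace I x) : ℝ :=
  ∑ i, inner ℝ (curvature I x (tangentONB I x i) v w) (tangentONB I x i)

/-- The Ricci operator `Q`, given by `g(Q v, w) = S(v, w)`. -/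
def ricciOperator (x : M) (v : TangentSpace I x) : TangentSpace I x :=
  ∑ i, ricci I x v (tangentONB I x i) • tangentONB I x i

/-- The scalar curvature, the trace of the Ricci tensor. -/
def scalarCurvature (x : M) : ℝ :=
  ∑ i, ricci I x (tangentONB I x i) (tangentONB I x i)

/-- The divergence of a vector field, the trace of `v ↦ ∇_v X`. -/
def divergence (X : Π x : M, TangentSpace I x) (x : M) : ℝ :=
  ∑ i, inner ℝ (leviCivita I M X x (tangentONB I x i)) (tangentONB I x i)

/-- The `g`-dual `1`-form of a vector field. -/
def flat (X : Π x : M, TangentSpace I x) : Π x : M, TangentSpace I x →L[ℝ] ℝ :=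
  fun x ↦ innerSL ℝ (X x)

/-- The vector field `γ♯` with `g(γ♯, ·) = γ`. -/
def sharp (γ : Π x : M, TangentSpace I x →L[ℝ] ℝ) : Π x : M, TangentSpace I x :=
  fun x ↦ ∑ i, γ x (tangentONB I x i) • tangentONB I x i

/-- The exterior derivative of a `1`-form,
`dγ(u, v) = U(γ(V)) - V(γ(U)) - γ([U, V])` at `x`, with `U, V` extending `u, v`. -/
def extDerivOneForm (γ : Π x : M, TangentSpace I x →L[ℝ] ℝ) (x : M) (u v : TangentSpace I x) : ℝ :=
  d% (fun y ↦ γ y (extendVec I v y)) x u - d% (fun y ↦ γ y (extendVec I u y)) x v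
    - γ x (mlieBracket I (extendVec I u) (extendVec I v) x)

/-- A harmonic `1`-form: closed and divergence-free. -/
structure IsHarmonicForm (γ : Π x : M, TangentSpace I x →L[ℝ] ℝ) : Prop where
  closed : ∀ (x : M) (u v : TangentSpace I x), extDerivOneForm I γ x u v = 0
  divergence_free : ∀ x : M, divergence I (sharp I γ) x = 0

/-- The Lie derivative of the metric,
`(L_X g)(v, w) = X(g(V, W)) - g([X, V], W) - g(V, [X, W])` at `x`, with `V, W` extending `v, w`. -/
def lieDerivMetric (X : Π x : M, TangentSpace I x) (x : M) (v w : TangentSpace I x) : ℝ :=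
  d% (fun y ↦ inner ℝ (extendVec I v y) (extendVec I w y)) x (X x)
    - inner ℝ (mlieBracket I X (extendVec I v) x) w - inner ℝ v (mlieBracket I X (extendVec I w) x)

/-- The `η`-Ricci soliton equation `L_ξ g + 2 S + 2 λ g + 2 μ η ⊗ η = 0`. -/
def IsEtaRicciSoliton (ξ : Π x : M, TangentSpace I x) (η : Π x : M, TangentSpace I x →L[ℝ] ℝ)
    (lam mu : ℝ) : Prop :=
  ∀ (x : M) (v w : TangentSpace I x),
    lieDerivMetric I ξ x v w + 2 * ricci I x v w + 2 * lam * inner ℝ v w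
      + 2 * mu * (η x v * η x w) = 0

end RicciSoliton

end

/-! Closedness of `η` makes `∇ξ` symmetric, so `L_ξ g = 2 g(∇ξ, ·)` and the soliton equation becomes
`S = -g(∇ξ, ·) - λ g - μ η ⊗ η` (`ricci_eq_of_soliton`). Taking the trace with `div ξ = 0` gives
`scal = -nλ - μ |ξ|²` (`scalarCurvature_eq_of_soliton`), hence `Z(scal) = -2μ g(∇_Z ξ, ξ)`.

The divergence of `S` can be computed from the same formula. Since `div ξ = 0`, the Ricci identity
turns the second-derivative term into `-S(Z, ξ)` (`IsONFrame.sum_inner_covD₂`), and the total is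
`-S(Z, ξ) - μ g(∇_Z ξ, ξ)`. The contracted Bianchi identity says that `Z(scal)` is twice this; the
`μ` terms cancel and `S(Z, ξ) = 0` remains, which is (i).

For (ii) with `μ ≠ 0`, the formula for `scal` suffices. With `μ = 0`, `scal` is always constant, so
`|ξ|` has to be shown constant. Part (i) gives `∇_ξ ξ = -λ ξ`; differentiating this once more and
taking the trace gives `|∇ξ|² = 0` (`leviCivita_eq_zero_of_soliton`), so `|ξ|²` is locally constant,
and constant on a connected `M`.

The bulk of the file is the Riemannian calculus this needs: orthonormal frames, smoothness of `∇`,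
tensoriality and symmetries of `R`, and both Bianchi identities. Everything is stated for fields
smooth near a point, because the extensions that define the tensors are only smooth there. -/

set_option linter.unusedSectionVars false

open Filter Topology

namespace RicciSoliton

/-! ### Functions and vector fields smooth near a point. -/

section Calculus

variable {E : Type*} [NormedAddCommGroup E] [NormedSpace ℝ E]
  {H : Type*} [TopologicalSpace H] (I : ModelWithCorners ℝ E H)
  {M : Type*} [TopologicalSpace M] [ChartedSpace H M]

/-- A function which is smooth in a neighbourhood of `p`. -/
def SmoothFunNear (f : M → ℝ) (p : M) : Prop :=
  ∀ᶠ y in 𝓝 p, CMDiffAt ∞ f y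

variable [IsManifold I ∞ M]

/-- A vector field which is smooth in a neighbourhood of `p`. -/
def SmoothNear (X : Π x : M, TangentSpace I x) (p : M) : Prop :=
  ∀ᶠ y in 𝓝 p, CMDiffAt ∞ (T% X) y

variable {I} {X Y Z : Π x : M, TangentSpace I x} {f g : M → ℝ} {p : M}

theorem SmoothFunNear.eventually (hf : SmoothFunNear I f p) : ∀ᶠ y in 𝓝 p, SmoothFunNear I f y :=
  eventually_eventually_nhds.2 hf

theorem SmoothFunNear.mdiff (hf : SmoothFunNear I f p) : MDiffAt f p :=
  hf.self_of_nhds.mdifferentiableAt (by simp)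

theorem SmoothFunNear.congr (hf : SmoothFunNear I f p) (h : ∀ᶠ y in 𝓝 p, g y = f y) :
    SmoothFunNear I g p := by
  filter_upwards [hf, h.eventually_nhds] with y h1 h2
  exact h1.congr_of_eventuallyEq h2

theorem SmoothFunNear.add (hf : SmoothFunNear I f p) (hg : SmoothFunNear I g p) :
    SmoothFunNear I (fun y ↦ f y + g y) p := by
  filter_upwards [hf, hg] with y h1 h2 using h1.add h2

theorem SmoothFunNear.sub (hf : SmoothFunNear I f p) (hg : SmoothFunNear I g p) :
    SmoothFunNear I (fun y ↦ f y - g y) p := by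
  filter_upwards [hf, hg] with y h1 h2 using h1.sub h2

theorem SmoothFunNear.neg (hf : SmoothFunNear I f p) : SmoothFunNear I (fun y ↦ - f y) p := by
  filter_upwards [hf] with y h1 using h1.neg

theorem SmoothFunNear.mul (hf : SmoothFunNear I f p) (hg : SmoothFunNear I g p) :
    SmoothFunNear I (fun y ↦ f y * g y) p := by
  filter_upwards [hf, hg] with y h1 h2 using h1.mul h2

variable (I) in
theorem SmoothFunNear.const (c : ℝ) : SmoothFunNear I (fun _ : M ↦ c) p :=
  Eventually.of_forall fun _ ↦ contMDiffAt_const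

theorem SmoothNear.eventually (hX : SmoothNear I X p) : ∀ᶠ y in 𝓝 p, SmoothNear I X y :=
  eventually_eventually_nhds.2 hX

theorem SmoothNear.contMDiffAt (hX : SmoothNear I X p) : CMDiffAt ∞ (T% X) p :=
  hX.self_of_nhds

theorem SmoothNear.mdiff (hX : SmoothNear I X p) : MDiffAt (T% X) p :=
  hX.contMDiffAt.mdifferentiableAt (by simp)

theorem SmoothNear.congr (hX : SmoothNear I X p) (h : ∀ᶠ y in 𝓝 p, Y y = X y) :
    SmoothNear I Y p := by
  filter_upwards [hX, h.eventually_nhds] with y h1 h2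
  refine h1.congr_of_eventuallyEq ?_
  filter_upwards [h2] with z hz using by simp [hz]

theorem SmoothNear.add (hX : SmoothNear I X p) (hY : SmoothNear I Y p) :
    SmoothNear I (X + Y) p := by
  filter_upwards [hX, hY] with y h1 h2 using h1.add_section h2

theorem SmoothNear.sub (hX : SmoothNear I X p) (hY : SmoothNear I Y p) :
    SmoothNear I (X - Y) p := by
  filter_upwards [hX, hY] with y h1 h2 using h1.sub_section h2

theorem SmoothNear.smul (hf : SmoothFunNear I f p) (hX : SmoothNear I X p) :
    SmoothNear I (f • X) p := by
  filter_upwards [hf, hX] with y h1 h2 using h1.smul_section h2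

variable (I) in
theorem SmoothNear.zero : SmoothNear I (0 : Π x : M, TangentSpace I x) p :=
  Eventually.of_forall fun y ↦ (contMDiff_zeroSection ℝ (fun x : M ↦ TangentSpace I x)) y

theorem SmoothNear.sum {ι : Type*} {s : Finset ι} {F : ι → Π x : M, TangentSpace I x}
    (hF : ∀ i ∈ s, SmoothNear I (F i) p) : SmoothNear I (∑ i ∈ s, F i) p := by
  classical
  induction s using Finset.induction_on with
  | empty => simpa using SmoothNear.zero I
  | insert a s ha ih => 
    rw [Finset.sum_insert ha]
    exact (hF a (by simp)).add (ih fun i hi ↦ hF i (by simp [hi]))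

section FiniteDimensional

variable [FiniteDimensional ℝ E]

theorem SmoothNear.mlieBracket (hX : SmoothNear I X p) (hY : SmoothNear I Y p) :
    SmoothNear I (mlieBracket I X Y) p := by
  have : CompleteSpace E := FiniteDimensional.complete ℝ E
  have : IsManifold I (minSmoothness ℝ 2) M := by
    simp only [minSmoothness_of_isRCLikeNormedField]
    infer_instance
  have : IsManifold I (((⊤ : ℕ∞) : WithTop ℕ∞) + 1) M := by simpa using ‹IsManifold I ∞ M›
  filter_upwards [hX, hY] with y h1 h2
  exact ContMDiffAt.mlieBracket_vectorField (m := ⊤) (n := ⊤) h1 h2 (by simp)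

theorem jacobi (hX : SmoothNear I X p) (hY : SmoothNear I Y p) (hZ : SmoothNear I Z p) :
    mlieBracket I X (mlieBracket I Y Z) p =
      mlieBracket I (mlieBracket I X Y) Z p + mlieBracket I Y (mlieBracket I X Z) p := by
  have : CompleteSpace E := FiniteDimensional.complete ℝ E
  have : IsManifold I (minSmoothness ℝ 3) M := by
    simp only [minSmoothness_of_isRCLikeNormedField]
    infer_instance
  have h2 : minSmoothness ℝ 2 ≤ ∞ := by
    simp only [minSmoothness_of_isRCLikeNormedField]
    exact WithTop.coe_le_coe.2 (le_top (a := (2 : ℕ∞)))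
  exact leibniz_identity_mlieBracket_apply (hX.contMDiffAt.of_le h2) (hY.contMDiffAt.of_le h2)
    (hZ.contMDiffAt.of_le h2)

end FiniteDimensional

theorem extendVec_self {x : M} (v : TangentSpace I x) : extendVec I v x = v :=
  FiberBundle.extend_apply_self E v

theorem smoothNear_extendVec {x : M} (v : TangentSpace I x) : SmoothNear I (extendVec I v) x := by
  obtain ⟨s, hs, h⟩ := FiberBundle.exists_contMDiffOn_extend (k := ∞) I E v
  filter_upwards [eventually_mem_nhds_iff.2 hs] with y hy
  exact h.contMDiffAt hy

end Calculus

/-! ### Local orthonormal frames. -/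

section Frame

variable {E : Type*} [NormedAddCommGroup E] [NormedSpace ℝ E]
  {H : Type*} [TopologicalSpace H] {I : ModelWithCorners ℝ E H}
  {M : Type*} [TopologicalSpace M] [ChartedSpace H M]
  [RiemannianBundle (fun x : M ↦ TangentSpace I x)]
  [FiniteDimensional ℝ E] [IsManifold I ∞ M]
  [IsContMDiffRiemannianBundle I ∞ E (fun x : M ↦ TangentSpace I x)]
  {X Y Z : Π x : M, TangentSpace I x} {f g : M → ℝ} {p : M}

theorem SmoothNear.inner_fun (hX : SmoothNear I X p) (hY : SmoothNear I Y p) :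
    SmoothFunNear I (fun y ↦ inner ℝ (X y) (Y y)) p := by
  filter_upwards [hX, hY] with y h1 h2
  exact ContMDiffAt.inner_bundle (E := fun x : M ↦ TangentSpace I x) (b := fun y ↦ y) h1 h2

theorem SmoothNear.normalize (hX : SmoothNear I X p) (h0 : ∀ᶠ y in 𝓝 p, X y ≠ 0) :
    SmoothNear I (fun y ↦ ‖X y‖⁻¹ • X y) p := by
  have h : SmoothFunNear I (fun y ↦ (√(inner ℝ (X y) (X y)))⁻¹) p := by
    filter_upwards [hX.inner_fun hX, h0] with y h1 h2
    have h3 : inner ℝ (X y) (X y) ≠ 0 := by simpa using h2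
    have h4 : ContDiffAt ℝ ∞ (fun t : ℝ ↦ (√t)⁻¹) (inner ℝ (X y) (X y)) :=
      (Real.contDiffAt_sqrt h3).inv (by
        rw [Real.sqrt_ne_zero']
        exact lt_of_le_of_ne real_inner_self_nonneg h3.symm)
    exact ContMDiffAt.comp (g := fun t : ℝ ↦ (√t)⁻¹) y h4.contMDiffAt h1
  refine (SmoothNear.smul h hX).congr (Eventually.of_forall fun y ↦ ?_)
  simp

/-- A smooth orthonormal frame near `p`. -/
structure IsONFrame (p : M) {ι : Type*} [Fintype ι] (e : ι → Π x : M, TangentSpace I x) :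
    Prop where
  smooth : ∀ i, SmoothNear I (e i) p
  orthonormal : ∀ᶠ y in 𝓝 p, Orthonormal ℝ (fun i ↦ e i y)
  card_eq : Fintype.card ι = Module.finrank ℝ E

/-- Gram-Schmidt applied pointwise to the frame of a local trivialization. -/
theorem exists_isONFrame (p : M) :
    ∃ e : Fin (Module.finrank ℝ E) → Π x : M, TangentSpace I x, IsONFrame p e := by
  let t := trivializationAt E (fun x : M ↦ TangentSpace I x) p
  let b := Module.finBasis ℝ E
  have hb : ∀ᶠ y in 𝓝 p, y ∈ t.baseSet :=
    t.open_baseSet.mem_nhds (FiberBundle.mem_baseSet_trivializationAt' p)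
  have hfr := t.isLocalFrameOn_localFrame_baseSet I ∞ b
  have hs : ∀ i, SmoothNear I (t.localFrame b i) p := fun i ↦ by
    filter_upwards [hb] with y hy using hfr.contMDiffAt t.open_baseSet hy i
  have hli : ∀ᶠ y in 𝓝 p, LinearIndependent ℝ (fun i ↦ t.localFrame b i y) := by
    filter_upwards [hb] with y hy using hfr.linearIndependent hy
  let G : Fin (Module.finrank ℝ E) → Π x : M, TangentSpace I x :=
    fun i y ↦ InnerProductSpace.gramSchmidt ℝ (fun i ↦ t.localFrame b i y) i
  have hne : ∀ i, ∀ᶠ y in 𝓝 p, G i y ≠ 0 := fun i ↦ by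
    filter_upwards [hli] with y hy using InnerProductSpace.gramSchmidt_ne_zero i hy
  have hG : ∀ m : ℕ, ∀ i : Fin (Module.finrank ℝ E), (i : ℕ) = m → SmoothNear I (G i) p := by
    intro m
    induction m using Nat.strong_induction_on with
    | _ m ih =>
      intro i him
      -- Writing the projections with the normalized earlier vectors makes their coefficients inner
      -- products of fields already known to be smooth.
      have h1 : SmoothNear I (t.localFrame b i - ∑ j ∈ Finset.Iio i,
          (fun y ↦ inner ℝ (‖G j y‖⁻¹ • G j y) (t.localFrame b i y)) •
            (fun y ↦ ‖G j y‖⁻¹ • G j y)) p := by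
        refine (hs i).sub (SmoothNear.sum fun j hj ↦ ?_)
        have hlt : (j : ℕ) < m := by rw [← him]; exact Fin.lt_def.1 (Finset.mem_Iio.1 hj)
        have hj' := (ih j hlt j rfl).normalize (hne j)
        exact SmoothNear.smul (hj'.inner_fun (hs i)) hj'
      refine h1.congr (Eventually.of_forall fun y ↦ ?_)
      simp only [G, Pi.sub_apply, Finset.sum_apply]
      rw [InnerProductSpace.gramSchmidt_def]
      congr 1
      refine Finset.sum_congr rfl fun j _ ↦ ?_
      rw [Submodule.starProjection_singleton]
      simp only [Pi.smul_apply', real_inner_smul_left, smul_smul, RCLike.ofReal_real_eq_id, id]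
      congr 1
      ring
  refine ⟨fun i y ↦ ‖G i y‖⁻¹ • G i y, fun i ↦ (hG _ i rfl).normalize (hne i), ?_, by simp⟩
  filter_upwards [hli] with y hy using InnerProductSpace.gramSchmidtNormed_orthonormal hy

end Frame

end RicciSoliton

namespace RicciSoliton

/-! ### Second derivatives of functions; smoothness of the Levi-Civita connection. -/

section Connection

variable {E : Type*} [NormedAddCommGroup E] [NormedSpace ℝ E]
  {H : Type*} [TopologicalSpace H] {I : ModelWithCorners ℝ E H}
  {M : Type*} [TopologicalSpace M] [ChartedSpace H M]
  [RiemannianBundle (fun x : M ↦ TangentSpace I x)]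
  [FiniteDimensional ℝ E] [IsManifold I ∞ M]
  [IsContMDiffRiemannianBundle I ∞ E (fun x : M ↦ TangentSpace I x)]
  {X X' Y Y' Z : Π x : M, TangentSpace I x} {f g : M → ℝ} {p : M}
  {ι : Type*} [Fintype ι] {e : ι → Π x : M, TangentSpace I x}

theorem IsONFrame.eventually (he : IsONFrame p e) : ∀ᶠ y in 𝓝 p, IsONFrame y e := by
  filter_upwards [eventually_all.2 fun i ↦ (he.smooth i).eventually,
    he.orthonormal.eventually_nhds] with y h1 h2 using ⟨h1, h2, he.card_eq⟩

theorem IsONFrame.exists_basis (he : IsONFrame p e) :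
    ∃ b : OrthonormalBasis ι ℝ (TangentSpace I p), ∀ i, b i = e i p := by
  have h := he.orthonormal.self_of_nhds
  refine ⟨OrthonormalBasis.mk h ?_, fun i ↦ by rw [OrthonormalBasis.coe_mk]⟩
  exact (h.linearIndependent.span_eq_top_of_card_eq_finrank' he.card_eq).ge

theorem IsONFrame.sum_inner_smul (he : IsONFrame p e) (v : TangentSpace I p) :
    ∑ i, inner ℝ (e i p) v • e i p = v := by
  obtain ⟨b, hb⟩ := he.exists_basis
  simpa only [hb] using b.sum_repr' v

/-- Expressing `X(f)` through Lie brackets lets smoothness of `X(f)` and the commutator formula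
follow from smoothness of brackets and the Jacobi identity. -/
theorem mvfderiv_smul_eq_bracket (hf : MDiffAt f p) (hY : MDiffAt (T% Y) p) :
    d% f p (X p) • Y p = mlieBracket I X (f • Y) p - f p • mlieBracket I X Y p := by
  rw [mlieBracket_smul_right hf hY]
  simp

theorem SmoothFunNear.mvfderiv (hf : SmoothFunNear I f p) (hX : SmoothNear I X p) :
    SmoothFunNear I (fun y ↦ d% f y (X y)) p := by
  obtain ⟨e, he⟩ := exists_isONFrame (I := I) p
  -- A unit field to pair with exists only in positive dimension; in dimension zero `X` vanishes.
  rcases Nat.eq_zero_or_pos (Module.finrank ℝ E) with h0 | h0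
  · have : Subsingleton E := Module.finrank_zero_iff.1 h0
    refine (SmoothFunNear.const I 0).congr (Eventually.of_forall fun y ↦ ?_)
    have : X y = 0 := Subsingleton.elim (α := E) _ _
    simp [this]
  · let i : Fin (Module.finrank ℝ E) := ⟨0, h0⟩
    have hi := he.smooth i
    have h1 : SmoothFunNear I
        (fun y ↦ inner ℝ ((mlieBracket I X (f • e i) - f • mlieBracket I X (e i)) y) (e i y)) p :=
      ((hX.mlieBracket (SmoothNear.smul hf hi)).sub
        (SmoothNear.smul hf (hX.mlieBracket hi))).inner_fun hi
    refine h1.congr ?_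
    filter_upwards [hf.eventually, hi.eventually, he.orthonormal] with y h2 h3 h4
    have h5 := mvfderiv_smul_eq_bracket (X := X) h2.mdiff h3.mdiff
    have h6 : inner ℝ (e i y) (e i y) = 1 := by
      rw [real_inner_self_eq_norm_sq, h4.1 i]; simp
    simp only [Pi.sub_apply, Pi.smul_apply']
    rw [← h5, real_inner_smul_left, h6, mul_one]

theorem mvfderiv_congr (h : ∀ᶠ y in 𝓝 p, f y = g y) : d% f p = d% g p := by
  have h' : mfderiv% f p = mfderiv% g p := EventuallyEq.mfderiv_eq h
  ext v
  exact DFunLike.congr_fun h' v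

/-- Expand the Jacobi identity for `X, Y, f • Z` and subtract `f` times the one for `X, Y, Z`: the
first-order terms cancel and the claim is left as the coefficient of `Z p ≠ 0`. -/
theorem mvfderiv_commutator (hf : SmoothFunNear I f p) (hX : SmoothNear I X p)
    (hY : SmoothNear I Y p) :
    d% (fun y ↦ d% f y (Y y)) p (X p) - d% (fun y ↦ d% f y (X y)) p (Y p) =
      d% f p (mlieBracket I X Y p) := by
  rcases subsingleton_or_nontrivial (TangentSpace I p) with hs | hn
  · rw [Subsingleton.elim (X p) 0, Subsingleton.elim (Y p) 0,
      Subsingleton.elim (mlieBracket I X Y p) 0]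
    simp
  obtain ⟨v, hv⟩ := exists_ne (0 : TangentSpace I p)
  have hZ := smoothNear_extendVec v
  have hZv := extendVec_self v
  set Z := extendVec I v
  have key : ∀ {U V : Π x : M, TangentSpace I x}, SmoothNear I U p → SmoothNear I V p →
      mlieBracket I U (mlieBracket I V (f • Z)) p =
        d% (fun y ↦ d% f y (V y)) p (U p) • v + d% f p (V p) • mlieBracket I U Z p
          + d% f p (U p) • mlieBracket I V Z p + f p • mlieBracket I U (mlieBracket I V Z) p := by
    intro U V hU hV
    have h1 : ∀ᶠ y in 𝓝 p, mlieBracket I V (f • Z) y =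
        ((fun y ↦ d% f y (V y)) • Z + f • mlieBracket I V Z) y := by
      filter_upwards [hf.eventually, hZ.eventually] with y h1 h2
      have := mvfderiv_smul_eq_bracket (X := V) h1.mdiff h2.mdiff
      simp only [Pi.add_apply, Pi.smul_apply']
      rw [this]
      abel
    have hVZ := hV.mlieBracket hZ
    have hVf := hf.mvfderiv hV
    rw [Filter.EventuallyEq.mlieBracket_vectorField_eq (EventuallyEq.refl _ U) h1,
      mlieBracket_add_right (SmoothNear.smul hVf hZ).mdiff (SmoothNear.smul hf hVZ).mdiff,
      mlieBracket_smul_right hVf.mdiff hZ.mdiff, mlieBracket_smul_right hf.mdiff hVZ.mdiff, hZv]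
    abel
  have h1 := jacobi hX hY (SmoothNear.smul hf hZ)
  have h2 := jacobi hX hY hZ
  have h3 := mvfderiv_smul_eq_bracket (X := mlieBracket I X Y) hf.mdiff hZ.mdiff
  rw [key hX hY, key hY hX, h2, eq_add_of_sub_eq h3.symm, hZv, smul_add] at h1
  have h4 : (d% (fun y ↦ d% f y (Y y)) p (X p) - d% (fun y ↦ d% f y (X y)) p (Y p) -
      d% f p (mlieBracket I X Y p)) • v = 0 := by
    rw [sub_smul, sub_smul]
    rw [← sub_eq_zero] at h1
    rw [← h1]
    abel
  rw [smul_eq_zero, or_iff_left hv] at h4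
  linarith

/-- The covariant derivative `∇_X Y` as a vector field. -/
noncomputable def covD (X Y : Π x : M, TangentSpace I x) : Π x : M, TangentSpace I x :=
  fun y ↦ leviCivita I M Y y (X y)

theorem covD_congr (hY : SmoothNear I Y p) (hX : X p = X' p) (h : ∀ᶠ y in 𝓝 p, Y' y = Y y) :
    covD X' Y' p = covD X Y p := by
  unfold covD
  rw [(leviCivita I M).isCovariantDerivativeOn.congr_of_eventuallyEq (hY.congr h).mdiff
    hY.mdiff univ_mem h, hX]

theorem covD_add_left : covD (X + X') Y = covD X Y + covD X' Y := by
  ext y; simp [covD]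

theorem covD_smul_left : covD (f • X) Y = f • covD X Y := by
  ext y; simp [covD]

theorem covD_add_right (hY : SmoothNear I Y p) (hY' : SmoothNear I Y' p) :
    covD X (Y + Y') p = covD X Y p + covD X Y' p := by
  simp [covD, (leviCivita I M).isCovariantDerivativeOn.add hY.mdiff hY'.mdiff]

theorem covD_smul_right (hf : SmoothFunNear I f p) (hY : SmoothNear I Y p) :
    covD X (f • Y) p = f p • covD X Y p + d% f p (X p) • Y p := by
  simp [covD, (leviCivita I M).isCovariantDerivativeOn.leibniz hY.mdiff hf.mdiff]

theorem covD_sub_right (hY : SmoothNear I Y p) (hY' : SmoothNear I Y' p) :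
    covD X (Y - Y') p = covD X Y p - covD X Y' p := by
  have h := covD_add_right (X := X) (hY.sub hY') hY'
  rw [sub_add_cancel] at h
  rw [h, add_sub_cancel_right]

theorem covD_sub_swap (hX : SmoothNear I X p) (hY : SmoothNear I Y p) :
    covD X Y p - covD Y X p = mlieBracket I X Y p :=
  (CovariantDerivative.torsion_eq_zero_iff _).1 (leviCivita_torsion I) hX.mdiff hY.mdiff

theorem mvfderiv_inner (hY : SmoothNear I Y p) (hZ : SmoothNear I Z p) :
    d% (fun y ↦ inner ℝ (Y y) (Z y)) p (X p) =
      inner ℝ (covD X Y p) (Z p) + inner ℝ (Y p) (covD X Z p) :=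
  (leviCivita_isMetricCompatible I).mvfderiv_inner_eq X hY.mdiff hZ.mdiff

/-- Koszul's formula, recovered from vanishing torsion and metric compatibility alone. It expresses
`∇_X Y` by brackets and derivatives of smooth functions, whence `SmoothNear.covD`. -/
theorem two_mul_inner_covD (hX : SmoothNear I X p) (hY : SmoothNear I Y p)
    (hZ : SmoothNear I Z p) : 2 * inner ℝ (covD X Y p) (Z p) = koszul I X Y Z p := by
  simp only [koszul]
  rw [mvfderiv_inner hY hZ, mvfderiv_inner hX hZ, mvfderiv_inner hX hY, ← covD_sub_swap hX hY,
    ← covD_sub_swap hX hZ, ← covD_sub_swap hY hZ]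
  simp only [inner_sub_left]
  rw [real_inner_comm (covD X Z p) (Y p), real_inner_comm (covD Y Z p) (X p),
    real_inner_comm (covD Z Y p) (X p)]
  ring

theorem SmoothNear.covD (hX : SmoothNear I X p) (hY : SmoothNear I Y p) :
    SmoothNear I (covD X Y) p := by
  obtain ⟨e, he⟩ := exists_isONFrame (I := I) p
  have hk : ∀ {Z : Π x : M, TangentSpace I x}, SmoothNear I Z p →
      SmoothFunNear I (koszul I X Y Z) p := fun {Z} hZ ↦
    ((((((hY.inner_fun hZ).mvfderiv hX).add ((hX.inner_fun hZ).mvfderiv hY)).sub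
      ((hX.inner_fun hY).mvfderiv hZ)).add ((hX.mlieBracket hY).inner_fun hZ)).sub
      ((hX.mlieBracket hZ).inner_fun hY)).sub ((hY.mlieBracket hZ).inner_fun hX)
  have h1 : SmoothNear I (∑ i, (fun y ↦ (1 / 2 : ℝ) * koszul I X Y (e i) y) • e i) p :=
    SmoothNear.sum fun i _ ↦
      SmoothNear.smul ((SmoothFunNear.const I _).mul (hk (he.smooth i))) (he.smooth i)
  refine h1.congr ?_
  filter_upwards [he.eventually, hX.eventually, hY.eventually] with y h2 h3 h4
  rw [← h2.sum_inner_smul (RicciSoliton.covD X Y y), Finset.sum_apply]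
  refine Finset.sum_congr rfl fun i _ ↦ ?_
  rw [Pi.smul_apply', ← two_mul_inner_covD h3 h4 (h2.smooth i), real_inner_comm]
  congr 1
  ring

end Connection

end RicciSoliton

namespace RicciSoliton

/-! ### Tensoriality and symmetries of the curvature; second Bianchi identity. -/

section Curvature

variable {E : Type*} [NormedAddCommGroup E] [NormedSpace ℝ E]
  {H : Type*} [TopologicalSpace H] {I : ModelWithCorners ℝ E H}
  {M : Type*} [TopologicalSpace M] [ChartedSpace H M]
  [RiemannianBundle (fun x : M ↦ TangentSpace I x)]
  [FiniteDimensional ℝ E] [IsManifold I ∞ M]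
  [IsContMDiffRiemannianBundle I ∞ E (fun x : M ↦ TangentSpace I x)]
  {U X X' Y Y' Z W W' : Π x : M, TangentSpace I x} {f g : M → ℝ} {p : M}
  {ι : Type*} [Fintype ι] {e : ι → Π x : M, TangentSpace I x}

/-- A map on vector fields that is linear over functions is given at a point by the components
in a frame. -/
theorem IsONFrame.tensorial_expand (he : IsONFrame p e) {A : Type*} [AddCommGroup A] [Module ℝ A]
    (Φ : (Π x : M, TangentSpace I x) → A)
    (hadd : ∀ X Y, SmoothNear I X p → SmoothNear I Y p → Φ (X + Y) = Φ X + Φ Y)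
    (hsmul : ∀ (f : M → ℝ) X, SmoothFunNear I f p → SmoothNear I X p → Φ (f • X) = f p • Φ X)
    (hcongr : ∀ X Y, SmoothNear I X p → (∀ᶠ y in 𝓝 p, Y y = X y) → Φ Y = Φ X)
    (hX : SmoothNear I X p) : Φ X = ∑ i, inner ℝ (e i p) (X p) • Φ (e i) := by
  classical
  have h0 : Φ 0 = 0 := by
    have := hsmul (fun _ ↦ 0) 0 (SmoothFunNear.const I 0) (SmoothNear.zero I)
    simpa using this
  have hF : ∀ i, SmoothNear I ((fun y ↦ inner ℝ (e i y) (X y)) • e i) p := fun i ↦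
    SmoothNear.smul ((he.smooth i).inner_fun hX) (he.smooth i)
  have hsum : ∀ s : Finset ι, Φ (∑ i ∈ s, (fun y ↦ inner ℝ (e i y) (X y)) • e i) =
      ∑ i ∈ s, inner ℝ (e i p) (X p) • Φ (e i) := by
    intro s
    induction s using Finset.induction_on with
    | empty => simpa using h0
    | insert a s ha ih =>
      rw [Finset.sum_insert ha, Finset.sum_insert ha,
        hadd _ _ (hF a) (SmoothNear.sum fun i _ ↦ hF i), ih,
        hsmul _ _ ((he.smooth a).inner_fun hX) (he.smooth a)]
  rw [← hsum]
  refine hcongr _ _ (SmoothNear.sum fun i _ ↦ hF i) ?_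
  filter_upwards [he.eventually] with y hy
  rw [Finset.sum_apply]
  exact (hy.sum_inner_smul (X y)).symm

theorem eq_of_tensorial {A : Type*} [AddCommGroup A] [Module ℝ A]
    (Φ : (Π x : M, TangentSpace I x) → A)
    (hadd : ∀ X Y, SmoothNear I X p → SmoothNear I Y p → Φ (X + Y) = Φ X + Φ Y)
    (hsmul : ∀ (f : M → ℝ) X, SmoothFunNear I f p → SmoothNear I X p → Φ (f • X) = f p • Φ X)
    (hcongr : ∀ X Y, SmoothNear I X p → (∀ᶠ y in 𝓝 p, Y y = X y) → Φ Y = Φ X)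
    (hX : SmoothNear I X p) (hY : SmoothNear I Y p) (h : X p = Y p) : Φ X = Φ Y := by
  obtain ⟨e, he⟩ := exists_isONFrame (I := I) p
  rw [he.tensorial_expand Φ hadd hsmul hcongr hX, he.tensorial_expand Φ hadd hsmul hcongr hY, h]

/-- The field `R(X, Y) W`. -/
noncomputable def curvF (X Y W : Π x : M, TangentSpace I x) : Π x : M, TangentSpace I x :=
  covD X (covD Y W) - covD Y (covD X W) - covD (mlieBracket I X Y) W

theorem curvF_apply : curvF X Y W p =
    covD X (covD Y W) p - covD Y (covD X W) p - covD (mlieBracket I X Y) W p := rfl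

theorem SmoothNear.curvF (hX : SmoothNear I X p) (hY : SmoothNear I Y p)
    (hW : SmoothNear I W p) : SmoothNear I (curvF X Y W) p :=
  ((hX.covD (hY.covD hW)).sub (hY.covD (hX.covD hW))).sub ((hX.mlieBracket hY).covD hW)

theorem curvF_swap : curvF X Y W p = - curvF Y X W p := by
  have h : mlieBracket I X Y p = - mlieBracket I Y X p := mlieBracket_swap_apply
  rw [curvF_apply, curvF_apply]
  have : covD (mlieBracket I X Y) W p = - covD (mlieBracket I Y X) W p := by
    simp [RicciSoliton.covD, h]
  rw [this]
  abel

theorem curvF_add_left (hX : SmoothNear I X p) (hX' : SmoothNear I X' p)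
    (hW : SmoothNear I W p) : curvF (X + X') Y W p = curvF X Y W p + curvF X' Y W p := by
  simp only [curvF_apply, covD_add_left, Pi.add_apply]
  rw [covD_add_right (hX.covD hW) (hX'.covD hW)]
  have : covD (mlieBracket I (X + X') Y) W p =
      covD (mlieBracket I X Y) W p + covD (mlieBracket I X' Y) W p := by
    simp [RicciSoliton.covD, mlieBracket_add_left hX.mdiff hX'.mdiff]
  rw [this]
  abel

theorem curvF_smul_left (hf : SmoothFunNear I f p) (hX : SmoothNear I X p)
    (hW : SmoothNear I W p) :
    curvF (f • X) Y W p = f p • curvF X Y W p := by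
  simp only [curvF_apply, covD_smul_left, Pi.smul_apply']
  rw [covD_smul_right hf (hX.covD hW)]
  have : covD (mlieBracket I (f • X) Y) W p =
      f p • covD (mlieBracket I X Y) W p - d% f p (Y p) • covD X W p := by
    simp [RicciSoliton.covD, mlieBracket_smul_left hf.mdiff hX.mdiff]
    abel
  rw [this, smul_sub, smul_sub]
  abel

theorem curvF_congr_left (hX : SmoothNear I X p) (hW : SmoothNear I W p)
    (h : ∀ᶠ y in 𝓝 p, X' y = X y) : curvF X' Y W p = curvF X Y W p := by
  have h1 : mlieBracket I X' Y p = mlieBracket I X Y p :=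
    Filter.EventuallyEq.mlieBracket_vectorField_eq h (EventuallyEq.refl _ Y)
  simp only [curvF_apply]
  rw [covD_congr (X := Y) (X' := Y) (Y' := covD X' W) (hX.covD hW) rfl
    (h.mono fun y hy ↦ by simp [RicciSoliton.covD, hy])]
  simp [RicciSoliton.covD, h1, h.self_of_nhds]

/-- The two middle terms are jointly symmetric in `X` and `Y`, so they drop out of the curvature;
the last one leaves the commutator of `X` and `Y` on `f`. -/
theorem covD_covD_smul (hf : SmoothFunNear I f p) (hY : SmoothNear I Y p)
    (hW : SmoothNear I W p) :
    covD X (covD Y (f • W)) p = f p • covD X (covD Y W) p + d% f p (X p) • covD Y W p +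
      d% f p (Y p) • covD X W p + d% (fun y ↦ d% f y (Y y)) p (X p) • W p := by
  have h1 : ∀ᶠ y in 𝓝 p, covD Y (f • W) y = (f • covD Y W + (fun y ↦ d% f y (Y y)) • W) y := by
    filter_upwards [hf.eventually, hW.eventually] with y h1 h2
    simpa using covD_smul_right h1 h2
  have h2 := SmoothNear.smul hf (hY.covD hW)
  have h3 := SmoothNear.smul (hf.mvfderiv hY) hW
  rw [covD_congr (h2.add h3) rfl h1, covD_add_right h2 h3, covD_smul_right hf (hY.covD hW),
    covD_smul_right (hf.mvfderiv hY) hW]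
  abel

theorem curvF_smul_right (hf : SmoothFunNear I f p) (hX : SmoothNear I X p)
    (hY : SmoothNear I Y p) (hW : SmoothNear I W p) :
    curvF X Y (f • W) p = f p • curvF X Y W p := by
  simp only [curvF_apply]
  rw [covD_covD_smul hf hY hW, covD_covD_smul hf hX hW, covD_smul_right hf hW,
    ← mvfderiv_commutator hf hX hY, sub_smul, smul_sub, smul_sub]
  abel

theorem curvF_add_right (hX : SmoothNear I X p)
    (hY : SmoothNear I Y p) (hW : SmoothNear I W p) (hW' : SmoothNear I W' p) :
    curvF X Y (W + W') p = curvF X Y W p + curvF X Y W' p := by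
  have key : ∀ {X Y : Π x : M, TangentSpace I x}, SmoothNear I Y p →
      covD X (covD Y (W + W')) p = covD X (covD Y W) p + covD X (covD Y W') p := by
    intro X Y hY
    rw [← covD_add_right (hY.covD hW) (hY.covD hW')]
    refine covD_congr ((hY.covD hW).add (hY.covD hW')) rfl ?_
    filter_upwards [hW.eventually, hW'.eventually] with y h1 h2
    exact covD_add_right h1 h2
  simp only [curvF_apply]
  rw [key hX, key hY, covD_add_right hW hW']
  abel

theorem curvF_congr_right (hX : SmoothNear I X p) (hY : SmoothNear I Y p) (hW : SmoothNear I W p)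
    (h : ∀ᶠ y in 𝓝 p, W' y = W y) : curvF X Y W' p = curvF X Y W p := by
  have key : ∀ {X Y : Π x : M, TangentSpace I x}, SmoothNear I Y p →
      covD X (covD Y W') p = covD X (covD Y W) p := by
    intro X Y hY
    refine covD_congr (hY.covD hW) rfl ?_
    filter_upwards [hW.eventually, h.eventually_nhds] with y h1 h2
    exact covD_congr h1 rfl h2
  simp only [curvF_apply]
  rw [key hX, key hY, covD_congr hW rfl h]

/-- By tensoriality in each slot, `curvature`, defined through chosen extensions, may be computed
with any fields having the right values at `p`. -/
theorem curvF_eq_of_eq (hX : SmoothNear I X p) (hX' : SmoothNear I X' p) (hY : SmoothNear I Y p)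
    (hY' : SmoothNear I Y' p) (hW : SmoothNear I W p) (hW' : SmoothNear I W' p)
    (h1 : X p = X' p) (h2 : Y p = Y' p) (h3 : W p = W' p) :
    curvF X Y W p = curvF X' Y' W' p := by
  have left : ∀ {X X' Y : Π x : M, TangentSpace I x}, SmoothNear I X p → SmoothNear I X' p →
      SmoothNear I Y p → X p = X' p → curvF X Y W p = curvF X' Y W p := fun hX hX' hY h ↦
    eq_of_tensorial (fun X ↦ curvF X _ W p) (fun _ _ h h' ↦ curvF_add_left h h' hW)
      (fun _ _ hf h ↦ curvF_smul_left hf h hW) (fun _ _ h h' ↦ curvF_congr_left h hW h')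
      hX hX' h
  -- The second slot is reduced to the first by antisymmetry.
  rw [left hX hX' hY h1, curvF_swap, left hY hY' hX' h2, ← curvF_swap]
  exact eq_of_tensorial (fun W ↦ curvF X' Y' W p) (fun _ _ h h' ↦ curvF_add_right hX' hY' h h')
      (fun _ _ hf h ↦ curvF_smul_right hf hX' hY' h)
      (fun _ _ h h' ↦ curvF_congr_right hX' hY' h h') hW hW' h3

theorem curvature_eq_curvF_extendVec (u v w : TangentSpace I p) :
    curvature I p u v w = curvF (extendVec I u) (extendVec I v) (extendVec I w) p := by
  simp [curvature, curvF_apply, covD, extendVec_self]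
  rfl

theorem curvF_eq_curvature (hX : SmoothNear I X p) (hY : SmoothNear I Y p)
    (hW : SmoothNear I W p) : curvF X Y W p = curvature I p (X p) (Y p) (W p) := by
  rw [curvature_eq_curvF_extendVec]
  exact curvF_eq_of_eq hX (smoothNear_extendVec _) hY (smoothNear_extendVec _) hW
    (smoothNear_extendVec _) (extendVec_self _).symm (extendVec_self _).symm
    (extendVec_self _).symm

theorem curvature_add_left (u u' v w : TangentSpace I p) :
    curvature I p (u + u') v w = curvature I p u v w + curvature I p u' v w := by
  have h := curvF_add_left (smoothNear_extendVec u) (smoothNear_extendVec u')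
    (Y := extendVec I v) (smoothNear_extendVec w)
  rw [curvF_eq_curvature ((smoothNear_extendVec u).add (smoothNear_extendVec u'))
    (smoothNear_extendVec v) (smoothNear_extendVec w), ← curvature_eq_curvF_extendVec,
    ← curvature_eq_curvF_extendVec] at h
  simpa only [Pi.add_apply, extendVec_self] using h

theorem curvature_smul_left (c : ℝ) (u v w : TangentSpace I p) :
    curvature I p (c • u) v w = c • curvature I p u v w := by
  have h := curvF_smul_left (SmoothFunNear.const I c) (smoothNear_extendVec u)
    (Y := extendVec I v) (smoothNear_extendVec w)
  rw [curvF_eq_curvature (SmoothNear.smul (SmoothFunNear.const I c) (smoothNear_extendVec u))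
    (smoothNear_extendVec v) (smoothNear_extendVec w), ← curvature_eq_curvF_extendVec] at h
  simpa only [Pi.smul_apply', extendVec_self] using h

theorem curvature_swap (u v w : TangentSpace I p) :
    curvature I p u v w = - curvature I p v u w := by
  rw [curvature_eq_curvF_extendVec, curvF_swap, ← curvature_eq_curvF_extendVec]

theorem mvfderiv_mvfderiv_inner (hY : SmoothNear I Y p) (hZ : SmoothNear I Z p)
    (hW : SmoothNear I W p) :
    d% (fun y ↦ d% (fun z ↦ inner ℝ (Z z) (W z)) y (Y y)) p (X p) =
      inner ℝ (covD X (covD Y Z) p) (W p) + inner ℝ (covD Y Z p) (covD X W p) +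
      inner ℝ (covD X Z p) (covD Y W p) + inner ℝ (Z p) (covD X (covD Y W) p) := by
  have h1 : ∀ᶠ y in 𝓝 p, d% (fun z ↦ inner ℝ (Z z) (W z)) y (Y y) =
      inner ℝ (covD Y Z y) (W y) + inner ℝ (Z y) (covD Y W y) := by
    filter_upwards [hZ.eventually, hW.eventually] with y h1 h2 using mvfderiv_inner h1 h2
  rw [mvfderiv_congr h1, mvfderiv_fun_add ((hY.covD hZ).inner_fun hW).mdiff
    (hZ.inner_fun (hY.covD hW)).mdiff, add_apply, mvfderiv_inner (hY.covD hZ) hW,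
    mvfderiv_inner hZ (hY.covD hW)]
  ring

/-- Metric compatibility, used twice, expands `XY - YX - [X, Y]` applied to the function `g(Z, W)`;
this operator kills functions. -/
theorem inner_curvF_swap (hX : SmoothNear I X p) (hY : SmoothNear I Y p) (hZ : SmoothNear I Z p)
    (hW : SmoothNear I W p) :
    inner ℝ (curvF X Y Z p) (W p) = - inner ℝ (curvF X Y W p) (Z p) := by
  have h := mvfderiv_commutator (hZ.inner_fun hW) hX hY
  rw [mvfderiv_mvfderiv_inner hY hZ hW, mvfderiv_mvfderiv_inner hX hZ hW,
    mvfderiv_inner hZ hW] at h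
  simp only [curvF_apply, inner_sub_left]
  rw [real_inner_comm (Z p) (covD X (covD Y W) p), real_inner_comm (Z p) (covD Y (covD X W) p),
    real_inner_comm (Z p) (covD _ W p)]
  linarith

theorem inner_curvature_swap (u v w z : TangentSpace I p) :
    inner ℝ (curvature I p u v w) z = - inner ℝ (curvature I p u v z) w := by
  have h := inner_curvF_swap (smoothNear_extendVec u) (smoothNear_extendVec v)
    (smoothNear_extendVec w) (smoothNear_extendVec z)
  simpa only [← curvature_eq_curvF_extendVec, extendVec_self] using h

/-- The field `(∇_X R)(Y, Z) W`. -/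
noncomputable def covDCurv (X Y Z W : Π x : M, TangentSpace I x) : Π x : M, TangentSpace I x :=
  covD X (curvF Y Z W) - curvF (covD X Y) Z W - curvF Y (covD X Z) W - curvF Y Z (covD X W)

theorem covDCurv_apply : covDCurv X Y Z W p = covD X (curvF Y Z W) p - curvF (covD X Y) Z W p -
    curvF Y (covD X Z) W p - curvF Y Z (covD X W) p := rfl

/-- Vanishing torsion, in the form in which the correction terms of the second Bianchi identity pair
up. -/
theorem curvF_covD_sub (hX : SmoothNear I X p) (hY : SmoothNear I Y p)
    (hW : SmoothNear I W p) :
    curvF (covD X Y) Z W p + curvF Z (covD Y X) W p = curvF (mlieBracket I X Y) Z W p := by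
  have h : ∀ᶠ y in 𝓝 p, covD X Y y = (covD Y X + mlieBracket I X Y) y := by
    filter_upwards [hX.eventually, hY.eventually] with y h1 h2
    rw [Pi.add_apply, ← covD_sub_swap h1 h2, add_sub_cancel]
  rw [curvF_congr_left ((hY.covD hX).add (hX.mlieBracket hY)) hW h,
    curvF_add_left (hY.covD hX) (hX.mlieBracket hY) hW, curvF_swap (X := Z)]
  abel

/-- The second Bianchi identity. -/
theorem covDCurv_cyclic (hX : SmoothNear I X p) (hY : SmoothNear I Y p) (hZ : SmoothNear I Z p)
    (hW : SmoothNear I W p) :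
    covDCurv X Y Z W p + covDCurv Y Z X W p + covDCurv Z X Y W p = 0 := by
  have expand : ∀ {X Y Z : Π x : M, TangentSpace I x}, SmoothNear I X p → SmoothNear I Y p →
      SmoothNear I Z p → covD X (curvF Y Z W) p = covD X (covD Y (covD Z W)) p -
        covD X (covD Z (covD Y W)) p - covD X (covD (mlieBracket I Y Z) W) p := by
    intro X Y Z hX hY hZ
    have h1 := hY.covD (hZ.covD hW)
    have h2 := hZ.covD (hY.covD hW)
    rw [curvF, covD_sub_right (h1.sub h2) ((hY.mlieBracket hZ).covD hW), covD_sub_right h1 h2]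
  have t1 := curvF_covD_sub (Z := Z) hX hY hW
  have t2 := curvF_covD_sub (Z := X) hY hZ hW
  have t3 := curvF_covD_sub (Z := Y) hZ hX hW
  -- After the pairing, the third derivatives of `W` cancel cyclically, as do the terms that
  -- differentiate `W` along a single bracket and another field. Only derivatives along double
  -- brackets remain, and Jacobi removes them.
  have hj : covD (mlieBracket I (mlieBracket I X Y) Z) W p +
      covD (mlieBracket I (mlieBracket I Y Z) X) W p +
      covD (mlieBracket I (mlieBracket I Z X) Y) W p = 0 := by
    simp only [RicciSoliton.covD, ← map_add]
    have h1 := jacobi hX hY hZ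
    have h2 : mlieBracket I (mlieBracket I Y Z) X p = - mlieBracket I X (mlieBracket I Y Z) p :=
      mlieBracket_swap_apply
    have h3 : mlieBracket I (mlieBracket I Z X) Y p = mlieBracket I Y (mlieBracket I X Z) p := by
      rw [mlieBracket_swap_apply, mlieBracket_swap (V := Z)]
      have := mlieBracket_const_smul_right (I := I) (V := Y) (c := (-1 : ℝ))
        (hX.mlieBracket hZ).mdiff
      simp only [neg_smul, one_smul] at this
      rw [this, neg_neg]
    rw [h2, h3, h1]
    simp
  simp only [covDCurv_apply, expand hX hY hZ, expand hY hZ hX, expand hZ hX hY]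
  rw [curvF_apply (X := mlieBracket I X Y)] at t1
  rw [curvF_apply (X := mlieBracket I Y Z)] at t2
  rw [curvF_apply (X := mlieBracket I Z X)] at t3
  rw [curvF_apply (X := Y) (Y := Z) (W := covD X W), curvF_apply (X := Z) (Y := X) (W := covD Y W),
    curvF_apply (X := X) (Y := Y) (W := covD Z W)]
  rw [← sub_eq_zero] at t1 t2 t3
  have h := congr($hj - $t1 - $t2 - $t3)
  simp only [sub_zero] at h
  rw [← h]
  abel

end Curvature

end RicciSoliton

namespace RicciSoliton

/-! ### Traces of bilinear forms in orthonormal bases. -/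

section LinearAlgebra

variable {V : Type*} [NormedAddCommGroup V] [InnerProductSpace ℝ V] {ι ι' : Type*} [Fintype ι]
  [Fintype ι']

theorem sum_inner_orthonormalBasis_eq (T : V →ₗ[ℝ] V) (b : OrthonormalBasis ι ℝ V)
    (b' : OrthonormalBasis ι' ℝ V) :
    ∑ i, inner ℝ (T (b i)) (b i) = ∑ i, inner ℝ (T (b' i)) (b' i) := by
  have h1 := T.trace_eq_sum_inner b
  rw [T.trace_eq_sum_inner b'] at h1
  simpa only [real_inner_comm] using h1.symm

theorem sum_bilin_orthonormalBasis_eq (B : V →ₗ[ℝ] V →ₗ[ℝ] ℝ) (b : OrthonormalBasis ι ℝ V)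
    (b' : OrthonormalBasis ι' ℝ V) : ∑ i, B (b i) (b i) = ∑ i, B (b' i) (b' i) := by
  have h : ∀ u v, B u v = inner ℝ ((∑ j, (B.flip (b j)).smulRight (b j)) u) v := by
    intro u v
    conv_lhs => rw [← b.sum_repr' v]
    simp [sum_inner, real_inner_smul_left, mul_comm]
  simp only [h]
  exact sum_inner_orthonormalBasis_eq _ b b'

/-- The `a i` play the role of the derivatives of an orthonormal frame. Their coefficient matrix is
skew, so the sum is a skew matrix contracted against a symmetric one. -/
theorem sum_bilin_skew_eq_zero (B : V →ₗ[ℝ] V →ₗ[ℝ] ℝ) (b : OrthonormalBasis ι ℝ V) (a : ι → V)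
    (ha : ∀ i j, inner ℝ (a i) (b j) + inner ℝ (b i) (a j) = 0) :
    ∑ i, (B (a i) (b i) + B (b i) (a i)) = 0 := by
  have h1 : ∀ i, B (a i) (b i) = ∑ j, inner ℝ (b j) (a i) * B (b j) (b i) := fun i ↦ by
    conv_lhs => rw [← b.sum_repr' (a i)]
    simp
  have h2 : ∀ i, B (b i) (a i) = ∑ j, inner ℝ (b j) (a i) * B (b i) (b j) := fun i ↦ by
    conv_lhs => rw [← b.sum_repr' (a i)]
    simp
  rw [Finset.sum_add_distrib, Finset.sum_congr rfl fun i _ ↦ h1 i,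
    Finset.sum_congr rfl fun i _ ↦ h2 i, Finset.sum_comm, ← Finset.sum_add_distrib]
  refine Finset.sum_eq_zero fun i _ ↦ ?_
  rw [← Finset.sum_add_distrib]
  refine Finset.sum_eq_zero fun j _ ↦ ?_
  have := ha j i
  rw [real_inner_comm] at this
  linear_combination B (b i) (b j) * this

end LinearAlgebra

/-! ### Ricci tensor and the contracted second Bianchi identity. -/

section Bianchi

variable {E : Type*} [NormedAddCommGroup E] [NormedSpace ℝ E]
  {H : Type*} [TopologicalSpace H] {I : ModelWithCorners ℝ E H}
  {M : Type*} [TopologicalSpace M] [ChartedSpace H M]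
  [RiemannianBundle (fun x : M ↦ TangentSpace I x)]
  [FiniteDimensional ℝ E] [IsManifold I ∞ M]
  [IsContMDiffRiemannianBundle I ∞ E (fun x : M ↦ TangentSpace I x)]
  {U X X' Y Y' Z W W' : Π x : M, TangentSpace I x} {f g : M → ℝ} {p : M}
  {ι : Type*} [Fintype ι] {e : ι → Π x : M, TangentSpace I x}

theorem SmoothFunNear.sum {ι : Type*} {s : Finset ι} {F : ι → M → ℝ}
    (hF : ∀ i ∈ s, SmoothFunNear I (F i) p) : SmoothFunNear I (fun y ↦ ∑ i ∈ s, F i y) p := by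
  classical
  induction s using Finset.induction_on with
  | empty => simpa using SmoothFunNear.const I 0
  | insert a s ha ih =>
    simp only [Finset.sum_insert ha]
    exact (hF a (by simp)).add (ih fun i hi ↦ hF i (by simp [hi]))

theorem mvfderiv_sum_apply {ι : Type*} {s : Finset ι} {F : ι → M → ℝ}
    (hF : ∀ i ∈ s, SmoothFunNear I (F i) p) (v : TangentSpace I p) :
    d% (fun y ↦ ∑ i ∈ s, F i y) p v = ∑ i ∈ s, d% (F i) p v := by
  classical
  induction s using Finset.induction_on with
  | empty => simp [mvfderiv_const]
  | insert a s ha ih =>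
    have h1 : ∀ i ∈ s, SmoothFunNear I (F i) p := fun i hi ↦ hF i (by simp [hi])
    simp only [Finset.sum_insert ha]
    rw [mvfderiv_fun_add (hF a (by simp)).mdiff (SmoothFunNear.sum h1).mdiff, add_apply, ih h1]

theorem IsONFrame.inner_covD_skew (he : IsONFrame p e) (i j : ι) :
    inner ℝ (covD Z (e i) p) (e j p) + inner ℝ (e i p) (covD Z (e j) p) = 0 := by
  rw [← mvfderiv_inner (he.smooth i) (he.smooth j)]
  have : ∀ᶠ y in 𝓝 p, inner ℝ (e i y) (e j y) = inner ℝ (e i p) (e j p) := by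
    classical
    filter_upwards [he.orthonormal] with y hy
    rw [orthonormal_iff_ite.1 hy i j, orthonormal_iff_ite.1 he.orthonormal.self_of_nhds i j]
  rw [mvfderiv_congr this, mvfderiv_const]
  rfl

theorem IsONFrame.sum_covD_eq_zero (he : IsONFrame p e)
    (B : TangentSpace I p →ₗ[ℝ] TangentSpace I p →ₗ[ℝ] ℝ) :
    ∑ i, (B (covD Z (e i) p) (e i p) + B (e i p) (covD Z (e i) p)) = 0 := by
  obtain ⟨b, hb⟩ := he.exists_basis
  simp only [← hb]
  refine sum_bilin_skew_eq_zero B b _ fun i j ↦ ?_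
  rw [hb, hb]
  exact he.inner_covD_skew i j

theorem IsONFrame.sum_bilin_tangentONB (he : IsONFrame p e)
    (B : TangentSpace I p →ₗ[ℝ] TangentSpace I p →ₗ[ℝ] ℝ) :
    ∑ i, B (tangentONB I p i) (tangentONB I p i) = ∑ i, B (e i p) (e i p) := by
  obtain ⟨b, hb⟩ := he.exists_basis
  simp only [← hb]
  exact sum_bilin_orthonormalBasis_eq B _ b

/-- The bilinear form `(u, u') ↦ g(R(u, v) w, u')`. -/
noncomputable def curvatureForm (v w : TangentSpace I p) :
    TangentSpace I p →ₗ[ℝ] TangentSpace I p →ₗ[ℝ] ℝ :=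
  LinearMap.mk₂ ℝ (fun u u' ↦ inner ℝ (curvature I p u v w) u')
    (fun u u' z ↦ by rw [curvature_add_left, inner_add_left])
    (fun c u z ↦ by rw [curvature_smul_left, real_inner_smul_left, smul_eq_mul])
    (fun u z z' ↦ by rw [inner_add_right])
    (fun c u z ↦ by rw [real_inner_smul_right, smul_eq_mul])

theorem curvatureForm_apply (u u' v w : TangentSpace I p) :
    curvatureForm v w u u' = inner ℝ (curvature I p u v w) u' := rfl

theorem IsONFrame.ricci_eq (he : IsONFrame p e) (v w : TangentSpace I p) :
    ricci I p v w = ∑ i, inner ℝ (curvature I p (e i p) v w) (e i p) :=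
  he.sum_bilin_tangentONB (curvatureForm v w)

/-- The Ricci tensor as a bilinear form. -/
noncomputable def ricciForm (p : M) : TangentSpace I p →ₗ[ℝ] TangentSpace I p →ₗ[ℝ] ℝ :=
  LinearMap.mk₂ ℝ (ricci I p)
    (fun v v' w ↦ by
      simp only [ricci, ← Finset.sum_add_distrib]
      refine Finset.sum_congr rfl fun i _ ↦ ?_
      rw [curvature_swap, curvature_add_left, curvature_swap v, curvature_swap v', neg_add,
        neg_neg, neg_neg, inner_add_left])
    (fun c v w ↦ by
      simp only [ricci, Finset.smul_sum]
      refine Finset.sum_congr rfl fun i _ ↦ ?_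
      rw [curvature_swap, curvature_smul_left, curvature_swap v, smul_neg, neg_neg,
        real_inner_smul_left, smul_eq_mul])
    (fun v w w' ↦ by
      simp only [ricci, ← Finset.sum_add_distrib]
      refine Finset.sum_congr rfl fun i _ ↦ ?_
      rw [inner_curvature_swap, inner_curvature_swap _ _ w, inner_curvature_swap _ _ w',
        inner_add_right, neg_add])
    (fun c v w ↦ by
      simp only [ricci, Finset.smul_sum]
      refine Finset.sum_congr rfl fun i _ ↦ ?_
      rw [inner_curvature_swap, inner_curvature_swap _ _ w, real_inner_smul_right, smul_eq_mul,
        mul_neg])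

theorem ricciForm_apply (v w : TangentSpace I p) : ricciForm p v w = ricci I p v w := rfl

theorem IsONFrame.eventually_ricci_eq (he : IsONFrame p e) (hY : SmoothNear I Y p)
    (hW : SmoothNear I W p) :
    ∀ᶠ y in 𝓝 p, ricci I y (Y y) (W y) = ∑ i, inner ℝ (curvF (e i) Y W y) (e i y) := by
  filter_upwards [he.eventually, hY.eventually, hW.eventually] with y h1 h2 h3
  rw [h1.ricci_eq]
  exact Finset.sum_congr rfl fun i _ ↦ by rw [curvF_eq_curvature (h1.smooth i) h2 h3]

theorem SmoothNear.ricci (hY : SmoothNear I Y p) (hW : SmoothNear I W p) :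
    SmoothFunNear I (fun y ↦ ricci I y (Y y) (W y)) p := by
  obtain ⟨e, he⟩ := exists_isONFrame (I := I) p
  exact (SmoothFunNear.sum fun i _ ↦
    ((he.smooth i).curvF hY hW).inner_fun (he.smooth i)).congr (he.eventually_ricci_eq hY hW)

theorem IsONFrame.scalarCurvature_eq (he : IsONFrame p e) :
    scalarCurvature I p = ∑ i, RicciSoliton.ricci I p (e i p) (e i p) :=
  he.sum_bilin_tangentONB (ricciForm p)

/-- The value `(∇_X S)(Y, W)` of the covariant derivative of the Ricci tensor at `p`. -/
noncomputable def covDRicci (X Y W : Π x : M, TangentSpace I x) (p : M) : ℝ :=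
  d% (fun y ↦ ricci I y (Y y) (W y)) p (X p) - ricci I p (covD X Y p) (W p)
    - ricci I p (Y p) (covD X W p)

/-- Taking traces commutes with covariant differentiation: the terms with `∇_Z e_i` cancel by
`sum_covD_eq_zero`. -/
theorem IsONFrame.sum_inner_covDCurv (he : IsONFrame p e) (hZ : SmoothNear I Z p)
    (hY : SmoothNear I Y p) (hW : SmoothNear I W p) :
    ∑ i, inner ℝ (covDCurv Z (e i) Y W p) (e i p) = covDRicci Z Y W p := by
  have hc : ∀ i, SmoothNear I (curvF (e i) Y W) p := fun i ↦ (he.smooth i).curvF hY hW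
  have h0 := he.sum_covD_eq_zero (Z := Z) (curvatureForm (Y p) (W p))
  simp only [curvatureForm_apply] at h0
  rw [covDRicci, mvfderiv_congr (he.eventually_ricci_eq hY hW),
    mvfderiv_sum_apply fun i _ ↦ (hc i).inner_fun (he.smooth i), he.ricci_eq, he.ricci_eq,
    ← Finset.sum_sub_distrib, ← Finset.sum_sub_distrib, ← sub_eq_zero, ← Finset.sum_sub_distrib,
    ← neg_eq_zero, ← h0, ← Finset.sum_neg_distrib]
  refine Finset.sum_congr rfl fun i _ ↦ ?_
  have hi := he.smooth i
  rw [mvfderiv_inner (hc i) hi, covDCurv_apply, curvF_eq_curvature (hZ.covD hi) hY hW,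
    curvF_eq_curvature hi (hZ.covD hY) hW, curvF_eq_curvature hi hY (hZ.covD hW),
    curvF_eq_curvature hi hY hW]
  simp only [inner_sub_left]
  ring

theorem covD_neg_right (hY : SmoothNear I Y p) : covD X (-Y) p = - covD X Y p := by
  have h := covD_sub_right (X := X) (SmoothNear.zero I) hY
  have h0 := covD_sub_right (X := X) hY hY
  rw [sub_self, sub_self] at h0
  rwa [h0, zero_sub, zero_sub] at h

theorem covDCurv_swap (hX : SmoothNear I X p) (hY : SmoothNear I Y p) (hW : SmoothNear I W p) :
    covDCurv Z X Y W p = - covDCurv Z Y X W p := by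
  have h : curvF X Y W = - curvF Y X W := funext fun y ↦ curvF_swap
  simp only [covDCurv_apply]
  rw [h, covD_neg_right (hY.curvF hX hW), curvF_swap (X := covD Z X), curvF_swap (X := X),
    curvF_swap (X := X)]
  abel

theorem inner_covDCurv_swap (hZ : SmoothNear I Z p) (hX : SmoothNear I X p)
    (hY : SmoothNear I Y p) (hW : SmoothNear I W p) (hU : SmoothNear I U p) :
    inner ℝ (covDCurv Z X Y W p) (U p) = - inner ℝ (covDCurv Z X Y U p) (W p) := by
  have h : ∀ᶠ y in 𝓝 p, inner ℝ (curvF X Y W y) (U y) = - inner ℝ (curvF X Y U y) (W y) := by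
    filter_upwards [hX.eventually, hY.eventually, hW.eventually, hU.eventually] with y h1 h2 h3 h4
    exact inner_curvF_swap h1 h2 h3 h4
  have h1 := mvfderiv_inner (X := Z) (hX.curvF hY hW) hU
  rw [mvfderiv_congr h, mvfderiv_fun_neg, neg_apply, mvfderiv_inner (hX.curvF hY hU) hW] at h1
  have h2 := inner_curvF_swap (hZ.covD hX) hY hW hU
  have h3 := inner_curvF_swap hX (hZ.covD hY) hW hU
  have h4 := inner_curvF_swap hX hY (hZ.covD hW) hU
  have h5 := inner_curvF_swap hX hY hW (hZ.covD hU)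
  simp only [covDCurv_apply, inner_sub_left]
  linarith

/-- The contracted second Bianchi identity, in a local orthonormal frame. -/
theorem IsONFrame.contracted_bianchi (he : IsONFrame p e) (hZ : SmoothNear I Z p) :
    ∑ j, covDRicci Z (e j) (e j) p = 2 * ∑ i, covDRicci (e i) Z (e i) p := by
  have h1 : ∑ j, covDRicci Z (e j) (e j) p =
      ∑ j, ∑ i, inner ℝ (covDCurv Z (e i) (e j) (e j) p) (e i p) :=
    Finset.sum_congr rfl fun j _ ↦ (he.sum_inner_covDCurv hZ (he.smooth j) (he.smooth j)).symm
  -- The divergence of `S` is written in two ways, here by skewness in the last pair of arguments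
  -- and in `h3` by skewness in the first pair. These match two of the three Bianchi terms, and pair
  -- symmetry of `R` is not needed.
  have h2 : ∑ i, covDRicci (e i) Z (e i) p =
      ∑ j, ∑ i, - inner ℝ (covDCurv (e i) (e j) Z (e j) p) (e i p) := by
    rw [Finset.sum_comm]
    refine Finset.sum_congr rfl fun i _ ↦ ?_
    rw [← he.sum_inner_covDCurv (he.smooth i) hZ (he.smooth i)]
    refine Finset.sum_congr rfl fun j _ ↦ ?_
    rw [inner_covDCurv_swap (he.smooth i) (he.smooth j) hZ (he.smooth i) (he.smooth j)]
  have h3 : ∑ i, covDRicci (e i) Z (e i) p =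
      ∑ j, ∑ i, - inner ℝ (covDCurv (e j) Z (e i) (e j) p) (e i p) := by
    refine Finset.sum_congr rfl fun j _ ↦ ?_
    rw [← he.sum_inner_covDCurv (he.smooth j) hZ (he.smooth j)]
    refine Finset.sum_congr rfl fun i _ ↦ ?_
    rw [covDCurv_swap (he.smooth i) hZ (he.smooth j), inner_neg_left]
  rw [two_mul, h1]
  nth_rw 1 [h2]
  rw [h3, ← sub_eq_zero, ← Finset.sum_add_distrib, ← Finset.sum_sub_distrib]
  refine Finset.sum_eq_zero fun j _ ↦ ?_
  rw [← Finset.sum_add_distrib, ← Finset.sum_sub_distrib]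
  refine Finset.sum_eq_zero fun i _ ↦ ?_
  -- Summed over `i` and `j` after pairing with `e i`, the three terms are the derivative of the
  -- scalar curvature and twice minus the divergence of `S`.
  have h := covDCurv_cyclic hZ (he.smooth i) (he.smooth j) (he.smooth j)
  have h' := congrArg (fun v ↦ inner ℝ v (e i p)) h
  simp only [inner_add_left, inner_zero_left] at h'
  linarith

theorem IsONFrame.sum_covDRicci (he : IsONFrame p e) :
    ∑ j, covDRicci Z (e j) (e j) p = d% (scalarCurvature I (M := M)) p (Z p) := by
  have h : ∀ᶠ y in 𝓝 p, scalarCurvature I y = ∑ i, RicciSoliton.ricci I y (e i y) (e i y) := by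
    filter_upwards [he.eventually] with y hy using hy.scalarCurvature_eq
  have h0 := he.sum_covD_eq_zero (Z := Z) (ricciForm p)
  simp only [ricciForm_apply] at h0
  rw [mvfderiv_congr h, mvfderiv_sum_apply fun i _ ↦ (he.smooth i).ricci (he.smooth i),
    ← sub_eq_zero, ← Finset.sum_sub_distrib, ← neg_eq_zero, ← h0, ← Finset.sum_neg_distrib]
  refine Finset.sum_congr rfl fun i _ ↦ ?_
  rw [covDRicci]
  ring

end Bianchi

end RicciSoliton

namespace RicciSoliton

/-! ### Solitons with harmonic `η`. -/

section Soliton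

variable {E : Type*} [NormedAddCommGroup E] [NormedSpace ℝ E]
  {H : Type*} [TopologicalSpace H] {I : ModelWithCorners ℝ E H}
  {M : Type*} [TopologicalSpace M] [ChartedSpace H M]
  [RiemannianBundle (fun x : M ↦ TangentSpace I x)]
  [FiniteDimensional ℝ E] [IsManifold I ∞ M]
  [IsContMDiffRiemannianBundle I ∞ E (fun x : M ↦ TangentSpace I x)]
  {U X X' Y Y' Z W W' : Π x : M, TangentSpace I x} {f g : M → ℝ} {p : M}
  {ι : Type*} [Fintype ι] {e : ι → Π x : M, TangentSpace I x}
  {ξ : Π x : M, TangentSpace I x} {lam mu : ℝ}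

theorem sharp_flat (X : Π x : M, TangentSpace I x) : sharp I (flat I X) = X := by
  ext y
  simp only [sharp, flat, innerSL_apply_apply]
  conv_rhs => rw [← (tangentONB I y).sum_repr' (X y)]
  exact Finset.sum_congr rfl fun i _ ↦ by rw [real_inner_comm]

theorem covD_extendVec_left (v : TangentSpace I p) (Y : Π x : M, TangentSpace I x) :
    covD (extendVec I v) Y p = leviCivita I M Y p v := by
  rw [covD, extendVec_self]

/-- For a torsion-free metric connection, `dη(v, w) = g(∇_v ξ, w) - g(∇_w ξ, v)`. -/
theorem IsHarmonicForm.inner_leviCivita_comm (h : IsHarmonicForm I (flat I ξ))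
    (hξ : SmoothNear I ξ p) (v w : TangentSpace I p) :
    inner ℝ (leviCivita I M ξ p v) w = inner ℝ (leviCivita I M ξ p w) v := by
  have hv := smoothNear_extendVec v
  have hw := smoothNear_extendVec w
  have h1 := h.closed p v w
  simp only [extDerivOneForm, flat, innerSL_apply_apply] at h1
  have h2 := mvfderiv_inner (X := extendVec I v) hξ hw
  have h3 := mvfderiv_inner (X := extendVec I w) hξ hv
  rw [extendVec_self] at h2 h3
  rw [h2, h3, ← covD_sub_swap hv hw, inner_sub_right] at h1
  simp only [covD_extendVec_left, extendVec_self] at h1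
  linarith

theorem lieDerivMetric_eq (hξ : SmoothNear I ξ p) (v w : TangentSpace I p) :
    lieDerivMetric I ξ p v w =
      inner ℝ (leviCivita I M ξ p v) w + inner ℝ v (leviCivita I M ξ p w) := by
  have hv := smoothNear_extendVec v
  have hw := smoothNear_extendVec w
  rw [lieDerivMetric, mvfderiv_inner hv hw, ← covD_sub_swap hξ hv, ← covD_sub_swap hξ hw,
    covD_extendVec_left, covD_extendVec_left, extendVec_self, extendVec_self, inner_sub_left,
    inner_sub_right]
  ring

theorem ricci_eq_of_soliton (h : IsHarmonicForm I (flat I ξ))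
    (hsol : IsEtaRicciSoliton I ξ (flat I ξ) lam mu)
    (hξ : SmoothNear I ξ p) (v w : TangentSpace I p) :
    ricci I p v w = - inner ℝ (leviCivita I M ξ p v) w - lam * inner ℝ v w
      - mu * (inner ℝ (ξ p) v * inner ℝ (ξ p) w) := by
  have h1 := hsol p v w
  rw [lieDerivMetric_eq hξ] at h1
  simp only [flat, innerSL_apply_apply] at h1
  have h2 := h.inner_leviCivita_comm hξ v w
  have h3 := real_inner_comm v (leviCivita I M ξ p w)
  linarith

/-- The bilinear form `(v, w) ↦ g(∇_v X, w)`. -/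
noncomputable def gradForm (X : Π x : M, TangentSpace I x) (p : M) :
    TangentSpace I p →ₗ[ℝ] TangentSpace I p →ₗ[ℝ] ℝ :=
  LinearMap.mk₂ ℝ (fun v w ↦ inner ℝ (leviCivita I M X p v) w)
    (fun u u' z ↦ by rw [map_add, inner_add_left])
    (fun c u z ↦ by rw [map_smul, real_inner_smul_left, smul_eq_mul])
    (fun u z z' ↦ by rw [inner_add_right])
    (fun c u z ↦ by rw [real_inner_smul_right, smul_eq_mul])

theorem gradForm_apply (v w : TangentSpace I p) :
    gradForm X p v w = inner ℝ (leviCivita I M X p v) w := rfl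

theorem IsONFrame.divergence_eq (he : IsONFrame p e) :
    divergence I X p = ∑ i, inner ℝ (covD (e i) X p) (e i p) :=
  he.sum_bilin_tangentONB (gradForm X p)

theorem IsHarmonicForm.divergence_eq_zero (h : IsHarmonicForm I (flat I ξ)) :
    divergence I ξ p = 0 := by
  rw [← h.divergence_free p, sharp_flat]

theorem scalarCurvature_eq_of_soliton (h : IsHarmonicForm I (flat I ξ))
    (hsol : IsEtaRicciSoliton I ξ (flat I ξ) lam mu) (hξ : SmoothNear I ξ p) :
    scalarCurvature I p =
      - (Module.finrank ℝ E * lam) - mu * inner ℝ (ξ p) (ξ p) := by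
  have h1 := h.divergence_eq_zero (p := p)
  have h2 : ∑ i, inner ℝ (ξ p) (tangentONB I p i) * inner ℝ (ξ p) (tangentONB I p i) =
      inner ℝ (ξ p) (ξ p) := by
    rw [← (tangentONB I p).sum_inner_mul_inner (ξ p) (ξ p)]
    exact Finset.sum_congr rfl fun i _ ↦ by rw [real_inner_comm (ξ p) (tangentONB I p i)]
  have h3 : ∑ i, inner ℝ (tangentONB I p i) (tangentONB I p i) = (Module.finrank ℝ E : ℝ) := by
    simp
    rfl
  rw [divergence] at h1
  simp only [scalarCurvature, ricci_eq_of_soliton h hsol hξ, Finset.sum_sub_distrib,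
    Finset.sum_neg_distrib, ← Finset.mul_sum]
  rw [h1, h2, h3]
  ring

/-- The second covariant derivative `∇²_{X, Y} W = ∇_X ∇_Y W - ∇_{∇_X Y} W`. -/
noncomputable def covD₂ (X Y W : Π x : M, TangentSpace I x) : Π x : M, TangentSpace I x :=
  covD X (covD Y W) - covD (covD X Y) W

/-- The Ricci identity. -/
theorem covD₂_sub_swap (hX : SmoothNear I X p) (hY : SmoothNear I Y p) :
    covD₂ X Y W p - covD₂ Y X W p = curvF X Y W p := by
  have h : covD (mlieBracket I X Y) W p = covD (covD X Y) W p - covD (covD Y X) W p := by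
    rw [RicciSoliton.covD, ← covD_sub_swap hX hY, map_sub]
    rfl
  simp only [covD₂, Pi.sub_apply, curvF_apply, h]
  abel

theorem IsONFrame.mvfderiv_divergence (he : IsONFrame p e)
    (hX : SmoothNear I X p) :
    d% (divergence I X) p (Z p) = ∑ i, inner ℝ (covD₂ Z (e i) X p) (e i p) := by
  have h : ∀ᶠ y in 𝓝 p, divergence I X y = ∑ i, inner ℝ (covD (e i) X y) (e i y) := by
    filter_upwards [he.eventually] with y hy using hy.divergence_eq
  have h0 := he.sum_covD_eq_zero (Z := Z) (gradForm X p)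
  simp only [gradForm_apply] at h0
  rw [mvfderiv_congr h,
    mvfderiv_sum_apply fun i _ ↦ ((he.smooth i).covD hX).inner_fun (he.smooth i),
    ← sub_eq_zero, ← Finset.sum_sub_distrib, ← h0]
  refine Finset.sum_congr rfl fun i _ ↦ ?_
  rw [mvfderiv_inner ((he.smooth i).covD hX) (he.smooth i), covD₂, Pi.sub_apply, inner_sub_left]
  simp only [RicciSoliton.covD]
  ring

/-- The Ricci identity swaps the two derivatives at the cost of `S(Z, X)`; the swapped trace is
`Z(div X) = 0`. -/
theorem IsONFrame.sum_inner_covD₂ (he : IsONFrame p e) (hZ : SmoothNear I Z p)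
    (hX : SmoothNear I X p) (hdiv : ∀ y, divergence I X y = 0) :
    ∑ i, inner ℝ (covD₂ (e i) Z X p) (e i p) = ricci I p (Z p) (X p) := by
  have h0 := he.mvfderiv_divergence (Z := Z) hX
  rw [mvfderiv_congr (g := fun _ ↦ 0) (Eventually.of_forall hdiv), mvfderiv_const] at h0
  rw [he.ricci_eq, ← sub_zero (∑ i, inner ℝ (covD₂ _ _ _ p) _)]
  have h1 : (0 : ℝ) = ∑ i, inner ℝ (covD₂ Z (e i) X p) (e i p) := h0
  rw [h1, ← Finset.sum_sub_distrib]
  refine Finset.sum_congr rfl fun i _ ↦ ?_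
  rw [← curvF_eq_curvature (he.smooth i) hZ hX, ← covD₂_sub_swap (he.smooth i) hZ, inner_sub_left]

theorem covDRicci_eq_of_soliton (h : IsHarmonicForm I (flat I ξ))
    (hsol : IsEtaRicciSoliton I ξ (flat I ξ) lam mu) (hξ : SmoothNear I ξ p)
    (hY : SmoothNear I Y p) (hW : SmoothNear I W p) :
    covDRicci X Y W p = - inner ℝ (covD₂ X Y ξ p) (W p)
      - mu * (inner ℝ (covD X ξ p) (Y p) * inner ℝ (ξ p) (W p)
        + inner ℝ (ξ p) (Y p) * inner ℝ (covD X ξ p) (W p)) := by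
  have h1 : ∀ᶠ y in 𝓝 p, ricci I y (Y y) (W y) = - inner ℝ (covD Y ξ y) (W y)
      - lam * inner ℝ (Y y) (W y) - mu * (inner ℝ (ξ y) (Y y) * inner ℝ (ξ y) (W y)) := by
    filter_upwards [hξ.eventually] with y hy using ricci_eq_of_soliton h hsol hy _ _
  have s1 := (hY.covD hξ).inner_fun hW
  have s2 := hY.inner_fun hW
  have s3 := hξ.inner_fun hY
  have s4 := hξ.inner_fun hW
  have s5 := SmoothFunNear.const I (p := p) lam
  have s6 := SmoothFunNear.const I (p := p) mu
  rw [covDRicci, mvfderiv_congr h1,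
    mvfderiv_fun_sub (s1.neg.sub (s5.mul s2)).mdiff (s6.mul (s3.mul s4)).mdiff,
    mvfderiv_fun_sub s1.neg.mdiff (s5.mul s2).mdiff, mvfderiv_fun_neg,
    mvfderiv_fun_mul s5.mdiff s2.mdiff, mvfderiv_fun_mul s6.mdiff (s3.mul s4).mdiff,
    mvfderiv_fun_mul s3.mdiff s4.mdiff, mvfderiv_const,
    mvfderiv_const, ricci_eq_of_soliton h hsol hξ, ricci_eq_of_soliton h hsol hξ]
  simp only [sub_apply, neg_apply, add_apply, smul_apply, smul_zero, add_zero, smul_eq_mul]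
  rw [mvfderiv_inner (hY.covD hξ) hW, mvfderiv_inner hY hW, mvfderiv_inner hξ hY,
    mvfderiv_inner hξ hW, covD₂, Pi.sub_apply, inner_sub_left]
  simp only [RicciSoliton.covD]
  ring

theorem mvfderiv_scalarCurvature_of_soliton (h : IsHarmonicForm I (flat I ξ))
    (hsol : IsEtaRicciSoliton I ξ (flat I ξ) lam mu) (hξ : SmoothNear I ξ p) :
    d% (scalarCurvature I (M := M)) p (Z p) = - 2 * mu * inner ℝ (covD Z ξ p) (ξ p) := by
  have h1 : ∀ᶠ y in 𝓝 p, scalarCurvature I y =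
      - (Module.finrank ℝ E * lam) - mu * inner ℝ (ξ y) (ξ y) := by
    filter_upwards [hξ.eventually] with y hy using scalarCurvature_eq_of_soliton h hsol hy
  have s1 := hξ.inner_fun hξ
  have s2 := SmoothFunNear.const I (p := p) mu
  have s3 := (SmoothFunNear.const I (p := p) (- (Module.finrank ℝ E * lam))).mdiff
  rw [mvfderiv_congr h1, mvfderiv_fun_sub s3 (s2.mul s1).mdiff,
    mvfderiv_fun_mul s2.mdiff s1.mdiff, mvfderiv_const,
    mvfderiv_const]
  simp only [sub_apply, smul_apply, smul_zero, add_zero, smul_eq_mul, zero_apply]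
  rw [mvfderiv_inner hξ hξ, real_inner_comm (covD Z ξ p) (ξ p)]
  ring

/-- The Ricci tensor of an `η`-Ricci soliton with harmonic `η` annihilates the soliton field. -/
theorem ricci_soliton_field_eq_zero (h : IsHarmonicForm I (flat I ξ))
    (hsol : IsEtaRicciSoliton I ξ (flat I ξ) lam mu) (hξ : SmoothNear I ξ p)
    (v : TangentSpace I p) : ricci I p v (ξ p) = 0 := by
  obtain ⟨e, he⟩ := exists_isONFrame (I := I) p
  have hZ := smoothNear_extendVec v
  have h1 := he.contracted_bianchi hZ
  rw [he.sum_covDRicci, mvfderiv_scalarCurvature_of_soliton h hsol hξ] at h1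
  have h2 := he.sum_inner_covD₂ hZ hξ fun y ↦ h.divergence_eq_zero
  -- Symmetry of `∇ξ` moves `e i` out of the derivative, and Parseval's identity then sums the
  -- products.
  have h3 : ∑ i, inner ℝ (covD (e i) ξ p) (extendVec I v p) * inner ℝ (ξ p) (e i p) =
      inner ℝ (covD (extendVec I v) ξ p) (ξ p) := by
    obtain ⟨b, hb⟩ := he.exists_basis
    rw [← b.sum_inner_mul_inner]
    refine Finset.sum_congr rfl fun i _ ↦ ?_
    rw [hb, real_inner_comm (ξ p) (e i p)]
    congr 1
    exact h.inner_leviCivita_comm hξ _ _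
  have h4 := he.divergence_eq (X := ξ)
  rw [h.divergence_eq_zero] at h4
  simp only [covDRicci_eq_of_soliton h hsol hξ hZ (he.smooth _), Finset.sum_sub_distrib,
    Finset.sum_neg_distrib, ← Finset.mul_sum, Finset.sum_add_distrib] at h1
  rw [h2, h3, ← h4, extendVec_self] at h1
  linarith

theorem ricciOperator_soliton_field_eq_zero (h : IsHarmonicForm I (flat I ξ))
    (hsol : IsEtaRicciSoliton I ξ (flat I ξ) lam mu) (hξ : SmoothNear I ξ p) :
    ricciOperator I p (ξ p) = 0 := by
  refine Finset.sum_eq_zero fun i _ ↦ ?_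
  have h1 := ricci_soliton_field_eq_zero h hsol hξ (tangentONB I p i)
  -- The operator uses `S(ξ, e_i)` while `S(e_i, ξ) = 0` is known; the soliton formula makes the
  -- symmetry of `S` visible.
  rw [ricci_eq_of_soliton h hsol hξ] at h1 ⊢
  rw [real_inner_comm (tangentONB I p i) (ξ p)] at h1
  rw [h.inner_leviCivita_comm hξ, real_inner_comm (tangentONB I p i) (ξ p),
    mul_comm (inner ℝ (ξ p) (ξ p)), h1, zero_smul]

/-- On a Ricci soliton whose soliton field is harmonic, that field is parallel. -/
theorem leviCivita_eq_zero_of_soliton (h : IsHarmonicForm I (flat I ξ))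
    (hsol : IsEtaRicciSoliton I ξ (flat I ξ) lam 0) (hξ : SmoothNear I ξ p)
    (v : TangentSpace I p) : leviCivita I M ξ p v = 0 := by
  obtain ⟨e, he⟩ := exists_isONFrame (I := I) p
  -- With `μ = 0`, `S(·, ξ) = 0` reads `∇_ξ ξ = -λ ξ`. It is needed on a neighbourhood because it is
  -- differentiated next.
  have h1 : ∀ᶠ y in 𝓝 p, covD ξ ξ y = ((fun _ ↦ - lam : M → ℝ) • ξ) y := by
    filter_upwards [hξ.eventually] with y hy
    refine ext_inner_right ℝ fun w ↦ ?_
    have h2 := ricci_soliton_field_eq_zero h hsol hy w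
    rw [ricci_eq_of_soliton h hsol hy, h.inner_leviCivita_comm hy, zero_mul, sub_zero] at h2
    rw [Pi.smul_apply', real_inner_smul_left, RicciSoliton.covD, real_inner_comm w (ξ y)]
    linarith
  have h2 : ∀ i, inner ℝ (covD₂ (e i) ξ ξ p) (e i p) =
      - lam * inner ℝ (covD (e i) ξ p) (e i p) - ‖covD (e i) ξ p‖ ^ 2 := fun i ↦ by
    have hc := SmoothFunNear.const I (p := p) (-lam)
    rw [covD₂, Pi.sub_apply, covD_congr (SmoothNear.smul hc hξ) rfl h1, covD_smul_right hc hξ,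
      mvfderiv_const, inner_sub_left, ← real_inner_self_eq_norm_sq]
    -- Symmetry of `∇ξ` turns the correction term of the second derivative into a square.
    have h3 : inner ℝ (covD (covD (e i) ξ) ξ p) (e i p) =
        inner ℝ (covD (e i) ξ p) (covD (e i) ξ p) := h.inner_leviCivita_comm hξ _ _
    simp [h3, real_inner_smul_left]
  have h3 := he.sum_inner_covD₂ hξ hξ fun y ↦ h.divergence_eq_zero
  have h4 := he.divergence_eq (X := ξ)
  rw [h.divergence_eq_zero] at h4
  rw [ricci_soliton_field_eq_zero h hsol hξ] at h3
  simp only [h2, Finset.sum_sub_distrib, ← Finset.mul_sum] at h3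
  -- The trace is `S(ξ, ξ) = 0` and `div ξ = 0`, so the sum of the squares `|∇_{e_i} ξ|²` vanishes.
  rw [← h4, mul_zero, zero_sub, neg_eq_zero,
    Finset.sum_eq_zero_iff_of_nonneg fun i _ ↦ sq_nonneg _] at h3
  rw [← he.sum_inner_smul v, map_sum]
  refine Finset.sum_eq_zero fun i hi ↦ ?_
  rw [map_smul]
  have h5 : leviCivita I M ξ p (e i p) = 0 :=
    norm_eq_zero.1 (sq_eq_zero_iff.1 (h3 i hi))
  rw [h5, smul_zero]

theorem mvfderiv_inner_self_of_soliton (h : IsHarmonicForm I (flat I ξ))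
    (hsol : IsEtaRicciSoliton I ξ (flat I ξ) lam 0) (hξ : SmoothNear I ξ p) :
    d% (fun y ↦ inner ℝ (ξ y) (ξ y)) p = 0 := by
  ext v
  have h1 := mvfderiv_inner (X := extendVec I v) hξ hξ
  rwa [covD_extendVec_left, leviCivita_eq_zero_of_soliton h hsol hξ, extendVec_self,
    inner_zero_left, inner_zero_right, add_zero] at h1

end Soliton

/-! ### Functions with zero derivative. -/

section LocallyConstant

variable {E : Type*} [NormedAddCommGroup E] [NormedSpace ℝ E]
  {H : Type*} [TopologicalSpace H] {I : ModelWithCorners ℝ E H} [I.Boundaryless]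
  {M : Type*} [TopologicalSpace M] [ChartedSpace H M] [IsManifold I 1 M] {f : M → ℝ}

/-- Without boundary the chart target is open, so it contains a ball around the image of `x`; on
this convex set `f` read in the chart has zero derivative. -/
theorem isLocallyConstant_of_mvfderiv_eq_zero (hf : MDiff f) (h0 : ∀ y, d% f y = 0) :
    IsLocallyConstant f := by
  rw [IsLocallyConstant.iff_eventually_eq]
  intro x
  obtain ⟨r, hr, hball⟩ := Metric.isOpen_iff.1 (isOpen_extChartAt_target (I := I) x)
    (extChartAt I x x) (mem_extChartAt_target x)
  have hd : ∀ z ∈ Metric.ball (extChartAt I x x) r,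
      HasFDerivAt (f ∘ (extChartAt I x).symm) (0 : E →L[ℝ] ℝ) z := by
    intro z hz
    have h1 : MDiffAt (extChartAt I x).symm z :=
      ((contMDiffOn_extChartAt_symm (n := 1) x).contMDiffAt
        ((isOpen_extChartAt_target x).mem_nhds (hball hz))).mdifferentiableAt one_ne_zero
    have h2 := (hf ((extChartAt I x).symm z)).hasMFDerivAt.comp z h1.hasMFDerivAt
    have h3 : mfderiv% f ((extChartAt I x).symm z) = 0 := by
      ext v
      exact DFunLike.congr_fun (h0 _) v
    rw [h3] at h2
    exact h2.hasFDerivAt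
  have hmem : ∀ᶠ y in 𝓝 x, extChartAt I x y ∈ Metric.ball (extChartAt I x x) r :=
    (continuousAt_extChartAt x).eventually (Metric.ball_mem_nhds _ hr)
  filter_upwards [hmem, extChartAt_source_mem_nhds (I := I) x] with y hy hys
  have h3 := (convex_ball (extChartAt I x x) r).is_const_of_fderivWithin_eq_zero (𝕜 := ℝ)
    (fun z hz ↦ (hd z hz).differentiableAt.differentiableWithinAt)
    (fun z hz ↦ by
      rw [fderivWithin_of_isOpen Metric.isOpen_ball hz, (hd z hz).fderiv])
    hy (Metric.mem_ball_self hr)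
  rwa [Function.comp_apply, Function.comp_apply, (extChartAt I x).left_inv hys,
    (extChartAt I x).left_inv (mem_extChartAt_source x)] at h3

end LocallyConstant

end RicciSoliton

/-! ### The main theorem. -/

theorem mainTheorem4 {n : ℕ} (hn : 2 < n)
    {M : Type*} [TopologicalSpace M] [ChartedSpace (EuclideanSpace ℝ (Fin n)) M]
    [IsManifold (𝓡 n) ∞ M]
    [RiemannianBundle (fun x : M ↦ TangentSpace (𝓡 n) x)]
    [IsContMDiffRiemannianBundle (𝓡 n) ∞ (EuclideanSpace ℝ (Fin n))
      (fun x : M ↦ TangentSpace (𝓡 n) x)]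
    (ξ : Π x : M, TangentSpace (𝓡 n) x)
    (hξ : ContMDiff (𝓡 n) (𝓡 n).tangent ∞ (fun x : M ↦ (ξ x : TangentBundle (𝓡 n) M)))
    (lam mu : ℝ)
    (hsol : RicciSoliton.IsEtaRicciSoliton (𝓡 n) ξ (RicciSoliton.flat (𝓡 n) ξ) lam mu)
    (hharm : RicciSoliton.IsHarmonicForm (𝓡 n) (RicciSoliton.flat (𝓡 n) ξ)) :
    (∀ x : M, RicciSoliton.ricciOperator (𝓡 n) x (ξ x) = 0) ∧
      (mu ≠ 0 ∨ PreconnectedSpace M →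
        ((∃ c : ℝ, ∀ x : M, RicciSoliton.scalarCurvature (𝓡 n) x = c) ↔ ∃ c : ℝ, ∀ x : M, ‖ξ x‖ = c)) := by
  have hsm : ∀ p, RicciSoliton.SmoothNear (𝓡 n) ξ p := fun p ↦ Filter.Eventually.of_forall hξ
  refine ⟨fun x ↦ RicciSoliton.ricciOperator_soliton_field_eq_zero hharm hsol (hsm x), ?_⟩
  have hscal : ∀ x, RicciSoliton.scalarCurvature (𝓡 n) x = - (n * lam) - mu * ‖ξ x‖ ^ 2 := by
    intro x
    rw [RicciSoliton.scalarCurvature_eq_of_soliton hharm hsol (hsm x), real_inner_self_eq_norm_sq,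
      finrank_euclideanSpace_fin]
  intro hcase
  by_cases hmu : mu = 0
  · subst hmu
    have hconn : PreconnectedSpace M := hcase.resolve_left fun h ↦ h rfl
    refine ⟨fun _ ↦ ?_, fun _ ↦ ⟨- (n * lam), fun x ↦ by rw [hscal]; ring⟩⟩
    have hlc : IsLocallyConstant fun y ↦ inner ℝ (ξ y) (ξ y) :=
      RicciSoliton.isLocallyConstant_of_mvfderiv_eq_zero (I := 𝓡 n)
        (fun y ↦ ((hsm y).inner_fun (hsm y)).mdiff)
        fun y ↦ RicciSoliton.mvfderiv_inner_self_of_soliton hharm hsol (hsm y)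
    -- `PreconnectedSpace` allows an empty `M`, where no point can supply the constant.
    rcases isEmpty_or_nonempty M with hM | ⟨⟨x₀⟩⟩
    · exact ⟨0, fun x ↦ hM.elim x⟩
    · refine ⟨‖ξ x₀‖, fun x ↦ ?_⟩
      have h := hlc.apply_eq_of_preconnectedSpace x x₀
      simp only [real_inner_self_eq_norm_sq] at h
      exact (pow_left_inj₀ (norm_nonneg _) (norm_nonneg _) two_ne_zero).1 h
  · constructor
    · rintro ⟨c, hc⟩
      -- The length obtained by solving `c = -nλ - μ |ξ|²`.
      refine ⟨√((- (n * lam) - c) / mu), fun x ↦ ?_⟩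
      have h : (- (n * lam) - c) / mu = ‖ξ x‖ ^ 2 := by
        rw [← hc x, hscal x]
        field_simp
        ring
      rw [h, Real.sqrt_sq (norm_nonneg _)]
    · rintro ⟨c, hc⟩
      exact ⟨- (n * lam) - mu * c ^ 2, fun x ↦ by rw [hscal, hc]⟩
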